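/- **Setting.** Let $H_{\mathbb R}$ be a separable real Hilbert space and $H$ its complexification, with inner product $\langle\cdot,\cdot\rangle$ antilinear on the left and linear on the right. Let $x\mapsto\bar x$ be a complex-linear self-adjoint involution of $H$, i.e. $\bar{\bar x}=x$ and $\langle\bar x,y\rangle=\langle x,\bar y\rangle$. Let $\Sigma(n)$ be the Coxeter group of type B, i.e. the group of bijections $\sigma$ of $\{\pm1,\dots,\pm n\}$ with $\sigma(-k)=-\sigma(k)$, generated by $\pi_0=(1,-1)$ and $\pi_i=(i,i+1)$, $1\le i\le n-1$ (each $\pi_i$ also exchanging $-i$ and $-(i+1)$). It acts on $H^{\otimes n}$: $\pi_0$ replaces the first factor $x_1$ by $\overline{x_1}$ and $\pi_i$ exchanges the factors $i$ and $i+1$. For $\sigma\in\Sigma(n)$ let $l_1(\sigma)$ and $l_2(\sigma)$ be the numbers of occurrences of $\pi_0$ and of $\pi_1,\dots,\pi_{n-1}$, respectively, in a shortest expression of $\sigma$ in the generators. For real $\alpha,q$ put, with $0^0=1$, $$P^{(n)}_{\alpha,q}=\sum_{\sigma\in\Sigma(n)}\alpha^{l_1(\sigma)}q^{l_2(\sigma)}\sigma\quad(n\ge1),\qquad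 P^{(0)}_{\alpha,q}=\mathrm{id}.$$ On the algebraic Fock space $\mathcal F=\bigoplus_{n\ge0}H^{\otimes n}$, $H^{\otimes0}=\mathbb C\Omega$, let $\langle f,g\rangle_{\alpha,q}=\sum_n\langle f_n,P^{(n)}_{\alpha,q}g_n\rangle_{0,0}$, where $\langle x_1\otimes\cdots\otimes x_n,y_1\otimes\cdots\otimes y_n\rangle_{0,0}=\prod_i\langle x_i,y_i\rangle$. Let $B^*(x)$ be the creation operator $x_1\otimes\cdots\otimes x_n\mapsto x_1\otimes\cdots\otimes x_n\otimes x$, let $B_{\alpha,q}(x)$ be its adjoint on $\mathcal F$ with respect to $\langle\cdot,\cdot\rangle_{\alpha,q}$, and put $G_{\alpha,q}(x)=B_{\alpha,q}(x)+B^*(x)$. Let $\mathcal P_2(2m)$ be the set of pair partitions of $\{1,\dots,2m\}$. For $\pi\in\mathcal P_2(2m)$ let $\mathrm{Cr}(\pi)$ be the number of crossings, i.e. of sets $\{V,W\}\subset\pi$ of two blocks for which there are $i,j\in V$ and $k,l\in W$ with $i<k<j<l$. Let $\mathcal{NC}_2(2m)=\{\pi\in\mathcal P_2(2m):\mathrm{Cr}(\pi)=0\}$.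 Let $\mathrm{In}(\pi)$ be the number of inner blocks, i.e. of blocks $V$ such that some block $W$ contains $i,j$ with $i<k<j$ for all $k\in V$. In products over blocks $\{i,j\}\in\pi$ we write $i<j$. **Corollary.** Let $m\ge0$ and let $x_1,\dots,x_{2m}\in H_{\mathbb R}$ satisfy $\overline{x_i}=x_i$ for all $i$. 1. Let $\alpha=0$ and $-1<q<1$. The adjoints $B_{0,q}(x)$, $x\in H$, exist, and $$\langle\Omega,G_{0,q}(x_1)\cdots G_{0,q}(x_{2m})\Omega\rangle_{0,q}=\sum_{\pi\in\mathcal P_2(2m)}q^{\mathrm{Cr}(\pi)}\prod_{\{i,j\}\in\pi}\langle x_i,x_j\rangle .$$ 2. Let $q=0$, $\alpha\in(-1,\infty)$, $t=1/(1+\alpha)$, so that $t\in(0,\infty)$ and $\alpha=(1-t)/t$. For $n\ge1$ one has $P^{(n)}_{\alpha,0}=1+\alpha\pi_0$. With respect to $\langle\cdot,\cdot\rangle_{0,0}$ this operator is strictly positive on $H^{\otimes n}$ if $\alpha<1$, and for every $\alpha>-1$ it is strictly positive on the span of the tensors $y_1\otimes\cdots\otimes y_n$ with $\overline{y_i}=y_i$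 for all $i$ (hence on all of $H^{\otimes n}$ if the involution is the identity). Here $P$ is strictly positive on a subspace if $\langle\xi,P\xi\rangle_{0,0}>0$ for every $\xi\ne0$ in it. The adjoints $B_{\alpha,0}(x)$, $x\in H$, exist, and the operators $\tilde G_t(x)=\sqrt t\,G_{\alpha,0}(x)$ satisfy $$\langle\Omega,\tilde G_t(x_1)\cdots\tilde G_t(x_{2m})\Omega\rangle_{\alpha,0}=\sum_{\pi\in\mathcal{NC}_2(2m)}t^{\mathrm{In}(\pi)}\prod_{\{i,j\}\in\pi}\langle x_i,x_j\rangle .$$ (In the case $\alpha=1$ of part 2 the form can be degenerate; then $B_{1,0}(x)$ denotes an arbitrarily fixed adjoint.) -/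

import Mathlib

open scoped TensorProduct DirectSum ComplexOrder

noncomputable section

namespace TypeBFock

/-! ### The Coxeter group of type B -/

/-- The `2n` points `±1, …, ±n`: the pair `(k, s)` stands for `s · (k + 1)`. -/
abbrev SignedPoint (n : ℕ) : Type := Fin n × ℤˣ

/-- `Σ(n)`: the bijections `σ` of the signed points such that `σ(-p) = -σ(p)`, under composition. -/
def typeBGroup (n : ℕ) : Subgroup (Equiv.Perm (SignedPoint n)) where
  carrier := {σ | ∀ (k : Fin n) (s : ℤˣ), σ (k, -s) = ((σ (k, s)).1, -(σ (k, s)).2)}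
  one_mem' := fun _ _ => rfl
  mul_mem' := by
    intro σ τ hσ hτ k s
    rw [Equiv.Perm.mul_apply, Equiv.Perm.mul_apply, hτ k s]
    exact hσ _ _
  inv_mem' := by
    intro σ hσ k s
    rw [Equiv.Perm.inv_eq_iff_eq, hσ, Prod.mk.eta]
    simp

instance (n : ℕ) : Fintype (typeBGroup n) := Fintype.ofFinite _

/-- The generators: `gen 0 = π₀` exchanges the points `1` and `-1`, and for `i ≥ 1`, `gen i = π_i`
exchanges `i` with `i + 1` and `-i` with `-(i + 1)`. -/
def gen {n : ℕ} (i : Fin n) : Equiv.Perm (SignedPoint n) :=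
  if i.val = 0 then Equiv.swap (i, 1) (i, -1)
  else Equiv.prodCongr (Equiv.swap ⟨i.val - 1, by omega⟩ i) (Equiv.refl ℤˣ)

/-- `w` is an irreducible (shortest) expression `σ = π_{i₁} ⋯ π_{i_k}`. -/
def IsReducedWord {n : ℕ} (w : List (Fin n)) (σ : Equiv.Perm (SignedPoint n)) : Prop :=
  (w.map gen).prod = σ ∧ ∀ v : List (Fin n), (v.map gen).prod = σ → w.length ≤ v.length

/-- The number of `π₀` in an irreducible expression of `σ`. It does not depend on the
expression, so that the infimum is over a one-element set. -/
def l₁ {n : ℕ} (σ : Equiv.Perm (SignedPoint n)) : ℕ :=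
  sInf {c | ∃ w : List (Fin n), IsReducedWord w σ ∧ w.countP (fun i => i.val = 0) = c}

/-- The number of `π_i`, `i ≥ 1`, in an irreducible expression of `σ`. It does not depend on the
expression, so that the infimum is over a one-element set. -/
def l₂ {n : ℕ} (σ : Equiv.Perm (SignedPoint n)) : ℕ :=
  sInf {c | ∃ w : List (Fin n), IsReducedWord w σ ∧ w.countP (fun i => i.val ≠ 0) = c}

/-- The permutation `k ↦ |σ(k)|` of `1, …, n` (applied to `σ⁻¹` it is the inverse permutation). -/
def absFun {n : ℕ} (σ : Equiv.Perm (SignedPoint n)) (k : Fin n) : Fin n := (σ (k, 1)).1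

theorem absFun_leftInverse {n : ℕ} {σ : Equiv.Perm (SignedPoint n)} (hσ : σ ∈ typeBGroup n) :
    Function.LeftInverse (absFun σ⁻¹) (absFun σ) := by
  intro k
  have h : ∀ s : ℤˣ, (σ⁻¹ ((σ (k, 1)).1, s)).1 = k := by
    intro s
    rcases Int.units_eq_one_or ((σ (k, 1)).2 * s) with h | h
    · have hs : s = (σ (k, 1)).2 := by
        rcases Int.units_eq_one_or s with h1 | h1 <;>
          rcases Int.units_eq_one_or (σ (k, 1)).2 with h2 | h2 <;> simp_all
      rw [hs, Prod.mk.eta]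
      simp
    · have hs : s = -(σ (k, 1)).2 := by
        rcases Int.units_eq_one_or s with h1 | h1 <;>
          rcases Int.units_eq_one_or (σ (k, 1)).2 with h2 | h2 <;> simp_all
      rw [hs, ← hσ k 1]
      simp
  exact h 1

/-- The permutation `k ↦ |σ(k)|` of `1, …, n`. -/
def absPerm {n : ℕ} (σ : typeBGroup n) : Equiv.Perm (Fin n) where
  toFun := absFun σ.1
  invFun := absFun σ.1⁻¹
  left_inv := absFun_leftInverse σ.2
  right_inv := by
    have h := absFun_leftInverse ((typeBGroup n).inv_mem σ.2)
    rwa [inv_inv] at h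

variable {H : Type*} [NormedAddCommGroup H] [InnerProductSpace ℂ H]

/-- `HR` is a real form of `H`, i.e. `H` is the complexification of the real inner product
space `HR`. -/
structure IsRealForm (HR : Submodule ℝ H) : Prop where
  inner_real : ∀ x ∈ HR, ∀ y ∈ HR, (inner ℂ x y).im = 0
  span : ∀ z : H, ∃ x ∈ HR, ∃ y ∈ HR, z = x + Complex.I • y

/-! ### The action on tensor powers and the type B symmetrization operator -/

/-- The action of `σ ∈ Σ(n)` on `H^{⊗n}`: the `j`-th factor of `σ(x₁ ⊗ ⋯ ⊗ x_n)` is `x_k` if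
`σ⁻¹(j) = k` and `J x_k` if `σ⁻¹(j) = -k`, where `J` is the involution of `H`. -/
def action (J : H →ₗ[ℂ] H) {n : ℕ} (σ : typeBGroup n) : (⨂[ℂ]^n H) →ₗ[ℂ] (⨂[ℂ]^n H) :=
  PiTensorProduct.map (fun j : Fin n => if (σ.1⁻¹ (j, 1)).2 = 1 then LinearMap.id else J) ∘ₗ
    (PiTensorProduct.reindex ℂ (fun _ : Fin n => H) (absPerm σ)).toLinearMap

theorem action_tprod (J : H →ₗ[ℂ] H) {n : ℕ} (σ : typeBGroup n) (x : Fin n → H) :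
    action J σ (PiTensorProduct.tprod ℂ x) = PiTensorProduct.tprod ℂ (fun j : Fin n =>
      if (σ.1⁻¹ (j, 1)).2 = 1 then x (σ.1⁻¹ (j, 1)).1 else J (x (σ.1⁻¹ (j, 1)).1)) := by
  rw [action, LinearMap.comp_apply, LinearEquiv.coe_coe, PiTensorProduct.reindex_tprod,
    PiTensorProduct.map_tprod]
  congr 1
  funext j
  split_ifs <;> rfl

/-- The operator `π₀` on `H^{⊗n}`, `n ≥ 1`: it applies `J` to the first factor. -/
def firstInvolution (J : H →ₗ[ℂ] H) (n : ℕ) : (⨂[ℂ]^n H) →ₗ[ℂ] (⨂[ℂ]^n H) :=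
  PiTensorProduct.map (fun j : Fin n => if j.val = 0 then J else LinearMap.id)

/-- The type B symmetrization operator `P_{α,q}^{(n)}` on `H^{⊗n}`, with `0 ^ 0 = 1`.
For `n = 0` it is the identity. -/
def symmetrizer (α q : ℝ) (J : H →ₗ[ℂ] H) (n : ℕ) : (⨂[ℂ]^n H) →ₗ[ℂ] (⨂[ℂ]^n H) :=
  ∑ σ : typeBGroup n, ((α : ℂ) ^ l₁ σ.1 * (q : ℂ) ^ l₂ σ.1) • action J σ

/-! ### The free inner product on tensor powers -/

/-- The linear functional `y₁ ⊗ ⋯ ⊗ y_n ↦ ∏ ⟨x_i, y_i⟩`. -/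
def innerFunctional {n : ℕ} (x : Fin n → H) : (⨂[ℂ]^n H) →ₗ[ℂ] ℂ :=
  PiTensorProduct.lift
    ((MultilinearMap.mkPiAlgebra ℂ (Fin n) ℂ).compLinearMap fun i => (innerₛₗ ℂ (x i)))

theorem innerFunctional_tprod {n : ℕ} (x y : Fin n → H) :
    innerFunctional x (PiTensorProduct.tprod ℂ y) = ∏ i, inner ℂ (x i) (y i) := by
  simp [innerFunctional]

/-- The antilinear functional `x₁ ⊗ ⋯ ⊗ x_n ↦ ∏ ⟨x_i, y_i⟩`. -/
def innerAntifunctional {n : ℕ} (y : Fin n → H) : (⨂[ℂ]^n H) →ₗ⋆[ℂ] ℂ :=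
  (starLinearEquiv ℂ (A := ℂ)).toLinearMap.comp (innerFunctional y)

theorem innerAntifunctional_tprod {n : ℕ} (x y : Fin n → H) :
    innerAntifunctional y (PiTensorProduct.tprod ℂ x) = ∏ i, inner ℂ (x i) (y i) := by
  simp [innerAntifunctional, innerFunctional_tprod]

theorem antilinear_ext {n : ℕ} {f g : (⨂[ℂ]^n H) →ₗ⋆[ℂ] ℂ}
    (h : ∀ x : Fin n → H, f (PiTensorProduct.tprod ℂ x) = g (PiTensorProduct.tprod ℂ x)) :
    f = g := by
  ext ξ
  induction ξ using PiTensorProduct.induction_on with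
  | smul_tprod r x => rw [map_smulₛₗ, map_smulₛₗ, h]
  | add a b ha hb => rw [map_add, map_add, ha, hb]

/-- The inner product `⟨·,·⟩_{0,0}` on `H^{⊗n}`, antilinear on the left and linear on the right. -/
def tensorInner (n : ℕ) : (⨂[ℂ]^n H) →ₗ⋆[ℂ] (⨂[ℂ]^n H) →ₗ[ℂ] ℂ :=
  (PiTensorProduct.lift
    { toFun := fun y : Fin n → H => innerAntifunctional y
      map_update_add' := by
        intro _ y i a b
        refine antilinear_ext fun x => ?_
        simp only [LinearMap.add_apply, innerAntifunctional_tprod]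
        rw [← Finset.mul_prod_erase _ _ (Finset.mem_univ i),
          ← Finset.mul_prod_erase _ _ (Finset.mem_univ i),
          ← Finset.mul_prod_erase _ _ (Finset.mem_univ i)]
        simp only [Function.update_self, inner_add_right, add_mul]
        congr 1 <;> congr 1 <;> refine Finset.prod_congr rfl fun j hj => ?_ <;>
          simp [Function.update_of_ne (Finset.ne_of_mem_erase hj)]
      map_update_smul' := by
        intro _ y i c a
        refine antilinear_ext fun x => ?_
        simp only [LinearMap.smul_apply, innerAntifunctional_tprod]
        rw [← Finset.mul_prod_erase _ _ (Finset.mem_univ i),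
          ← Finset.mul_prod_erase _ _ (Finset.mem_univ i)]
        simp only [Function.update_self, inner_smul_right, smul_eq_mul, mul_assoc]
        congr 2
        refine Finset.prod_congr rfl fun j hj => ?_
        simp [Function.update_of_ne (Finset.ne_of_mem_erase hj)] }).flip

theorem tensorInner_tprod {n : ℕ} (x y : Fin n → H) :
    tensorInner n (PiTensorProduct.tprod ℂ x) (PiTensorProduct.tprod ℂ y) =
      ∏ i, inner ℂ (x i) (y i) := by
  rw [tensorInner, LinearMap.flip_apply, PiTensorProduct.lift.tprod]
  exact innerAntifunctional_tprod x y

/-! ### The Fock space -/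

variable (H) in
/-- The algebraic full Fock space `⨁ₙ H^{⊗n}`; its multiplication is the tensor product. -/
abbrev Fock : Type _ := ⨁ n : ℕ, ⨂[ℂ]^n H

variable (H) in
/-- The vacuum vector, the empty tensor product in `H^{⊗0}`. -/
def vacuum : Fock H :=
  DirectSum.lof ℂ ℕ (fun n => ⨂[ℂ]^n H) 0 (PiTensorProduct.tprod ℂ Fin.elim0)

/-- The deformed form `⟨f, g⟩_{α,q} = ∑ₙ ⟨fₙ, P_{α,q}^{(n)} gₙ⟩_{0,0}`. -/
def fockForm (α q : ℝ) (J : H →ₗ[ℂ] H) (f g : Fock H) : ℂ :=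
  DirectSum.toModule ℂ ℕ ℂ (fun n => tensorInner n (f n) ∘ₗ symmetrizer α q J n) g

/-- The creation operator `x₁ ⊗ ⋯ ⊗ x_n ↦ x₁ ⊗ ⋯ ⊗ x_n ⊗ x`. -/
def creation (x : H) : Module.End ℂ (Fock H) :=
  LinearMap.mulRight ℂ
    (DirectSum.lof ℂ ℕ (fun n => ⨂[ℂ]^n H) 1 (PiTensorProduct.tprod ℂ fun _ => x))

/-- `S` is an adjoint of `T` with respect to `⟨·,·⟩_{α,q}`. -/
def IsFockAdjoint (α q : ℝ) (J : H →ₗ[ℂ] H) (T S : Module.End ℂ (Fock H)) : Prop :=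
  ∀ f g : Fock H, fockForm α q J (T f) g = fockForm α q J f (S g)

open Classical in
/-- The annihilation operator: the adjoint of `creation x` with respect to `⟨·,·⟩_{α,q}`. -/
def annihilation (α q : ℝ) (J : H →ₗ[ℂ] H) (x : H) : Module.End ℂ (Fock H) :=
  if h : ∃ S, IsFockAdjoint α q J (creation x) S then h.choose else 0

/-- The Gaussian operator `G_{α,q}(x)`. -/
def gaussian (α q : ℝ) (J : H →ₗ[ℂ] H) (x : H) : Module.End ℂ (Fock H) :=
  annihilation α q J x + creation x

/-! ### Pair partitions and their statistics -/

open Classical in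
/-- The set of pair partitions of an `n`-element ordered set. -/
def pairPartitions (n : ℕ) : Finset (Finpartition (Finset.univ : Finset (Fin n))) :=
  Finset.univ.filter fun π => ∀ V ∈ π.parts, V.card = 2

open Classical in
/-- The number of crossings: of the sets `{V, W}` of two blocks with `i, j ∈ V`, `k, l ∈ W` and
`i < k < j < l` for some `i, j, k, l`. -/
def crossings {n : ℕ} (π : Finpartition (Finset.univ : Finset (Fin n))) : ℕ :=
  ((π.parts.powersetCard 2).filter fun S => ∃ V ∈ S, ∃ W ∈ S, V ≠ W ∧
    ∃ i ∈ V, ∃ j ∈ V, ∃ k ∈ W, ∃ l ∈ W, i < k ∧ k < j ∧ j < l).card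

/-- The set of noncrossing pair partitions. -/
def noncrossingPairPartitions (n : ℕ) : Finset (Finpartition (Finset.univ : Finset (Fin n))) :=
  (pairPartitions n).filter fun π => crossings π = 0

/-- The block `W` covers the block `V`. -/
def Covers {n : ℕ} (W V : Finset (Fin n)) : Prop :=
  ∃ i ∈ W, ∃ j ∈ W, ∀ k ∈ V, i < k ∧ k < j

open Classical in
/-- The number of inner blocks, i.e. of blocks covered by some block. -/
def innerBlocks {n : ℕ} (π : Finpartition (Finset.univ : Finset (Fin n))) : ℕ :=
  (π.parts.filter fun V => ∃ W ∈ π.parts, Covers W V).card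

/-- `∏ ⟨x_i, x_j⟩` over the blocks `{i, j}` of the pair partition `π`, written with `i < j`. -/
def pairProduct {n : ℕ} (π : Finpartition (Finset.univ : Finset (Fin n))) (x : Fin n → H) : ℂ :=
  ∏ p : Fin n × Fin n with p.1 < p.2 ∧ {p.1, p.2} ∈ π.parts, inner ℂ (x p.1) (x p.2)

end TypeBFock

end

/-!
When `αq = 0`, the sum defining `P^{(n+1)}` is indexed by permutations (`α = 0`) or has two terms
(`q = 0`), and splitting off the last tensor factor shows that a weighted sum of contractions,
`annihilate`, is an adjoint of the creation operator. The moment formula is obtained by applying the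
operators `G(x_i)` to `Ω` from right to left. Each vector met on the way is a combination of tensor
products of the `x_i` with `i` in a finite set `s` of indices: `G(x_j)` either adds `j` to `s` or
pairs `j` with some `k ∈ s`, with a weight that depends on the numbers of elements of `s` on either
side of `k`. As the elements of `s` will be paired with indices to the left of `j`, this weight is
exactly what the pair `(j, k)` contributes to the numbers of crossings and of inner pairs.

The form can be degenerate, in which case an adjoint is determined only modulo the radical of the
form. The creation operators and all their adjoints preserve the radical, on which the moments do
not depend, so the arbitrary adjoint in `G` may be replaced by `annihilate`.
-/

noncomputable section

namespace TypeBFock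

open Equiv (Perm swap)
open PiTensorProduct (tprod)
open scoped Finset

/-! ### Inversions of permutations -/

section Inversions

variable {ι : Type*} [LinearOrder ι]

theorem exists_descent [Finite ι] {τ : Perm ι} (hτ : τ ≠ 1) : ∃ i j, i ⋖ j ∧ τ j < τ i := by
  let _ := Fintype.ofFinite ι
  let _ := Fintype.toLocallyFiniteOrder (α := ι)
  by_contra! hle
  have hmono : StrictMono τ := (strictMono_iff_forall_covBy τ).mpr fun i j hij =>
    (hle i j hij).lt_of_ne (τ.injective.ne hij.lt.ne)
  have hid : (⟨τ, hmono.le_iff_le⟩ : ι ≃o ι) = OrderIso.refl ι := Subsingleton.elim _ _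
  exact hτ (congrArg RelIso.toEquiv hid)

variable [Fintype ι]

/-- The number of inversions of a permutation of a finite linear order, i.e. the length of the
permutation with respect to the adjacent transpositions. -/
def inversions (τ : Perm ι) : ℕ := #{p : ι × ι | p.1 < p.2 ∧ τ p.2 < τ p.1}

variable (τ : Perm ι) {i j : ι}

theorem inversions_one : inversions (1 : Perm ι) = 0 :=
  Finset.card_eq_zero.mpr <| Finset.filter_eq_empty_iff.mpr fun _ _ h => lt_asymm h.1 h.2

theorem inversions_inv : inversions τ⁻¹ = inversions τ :=
  Finset.card_equiv ((Equiv.prodComm ι ι).trans (τ⁻¹.prodCongr τ⁻¹)) fun p => by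
    simp [and_comm]

theorem inversions_mul_swap_of_lt (hij : i ⋖ j) (h : τ i < τ j) :
    inversions (τ * swap i j) = inversions τ + 1 := by
  have hset : ({p : ι × ι | p.1 < p.2 ∧ (τ * swap i j) p.2 < (τ * swap i j) p.1} : Finset _) =
      insert (i, j) (Finset.map ((swap i j).prodCongr (swap i j)).toEmbedding
        {p : ι × ι | p.1 < p.2 ∧ τ p.2 < τ p.1}) := by
    ext ⟨a, b⟩
    simp only [Finset.mem_insert, Finset.mem_map_equiv, Finset.mem_filter_univ,
      Perm.mul_apply, Equiv.prodCongr_symm, Equiv.symm_swap, Equiv.prodCongr_apply,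
      Prod.map_apply, Prod.mk.injEq, Equiv.swap_apply_def]
    have hlt := hij.lt
    have hnot : ∀ c, i < c → ¬ c < j := fun c => @hij.2 c
    have ha := hnot a
    have hb := hnot b
    grind
  rw [inversions, hset, Finset.card_insert_of_notMem, Finset.card_map, inversions]
  simp [Finset.mem_map_equiv, hij.lt.le]

theorem inversions_mul_swap_of_gt (hij : i ⋖ j) (h : τ j < τ i) :
    inversions (τ * swap i j) + 1 = inversions τ := by
  rw [← inversions_mul_swap_of_lt (τ * swap i j) hij (by simpa using h), mul_assoc,
    Equiv.swap_mul_self, mul_one]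

theorem inversions_mul_swap_le (hij : i ⋖ j) :
    inversions (τ * swap i j) ≤ inversions τ + 1 := by
  rcases (τ.injective.ne hij.lt.ne).lt_or_gt with h | h
  · exact (inversions_mul_swap_of_lt τ hij h).le
  · have := inversions_mul_swap_of_gt τ hij h
    omega

end Inversions

/-! ### Words in the generators of the Coxeter group -/

section Words

variable {n : ℕ}

/-- The embedding of the permutations of `{1, …, n}` into the Coxeter group of type B. -/
def unsigned : Perm (Fin n) →* Perm (SignedPoint n) where
  toFun τ := Equiv.prodCongr τ (Equiv.refl ℤˣ)
  map_one' := rfl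
  map_mul' _ _ := rfl

/-- The sign change `k ↔ -k`, a reflection of the Coxeter group of type B. -/
def signChange (k : Fin n) : Perm (SignedPoint n) := swap (k, 1) (k, -1)

theorem unsigned_apply (τ : Perm (Fin n)) (k : Fin n) (s : ℤˣ) : unsigned τ (k, s) = (τ k, s) :=
  rfl

theorem unsigned_injective : Function.Injective (unsigned (n := n)) := fun _ _ h =>
  Equiv.ext fun k => congrArg Prod.fst (DFunLike.congr_fun h (k, 1))

theorem unsigned_mem (τ : Perm (Fin n)) : unsigned τ ∈ typeBGroup n := fun _ _ => rfl

theorem signChange_apply (j k : Fin n) (s : ℤˣ) :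
    signChange j (k, s) = (k, if k = j then -s else s) := by
  rw [signChange, Equiv.swap_apply_def]
  rcases Int.units_eq_one_or s with rfl | rfl <;> by_cases h : k = j <;> simp [h]

theorem signChange_mul_self (k : Fin n) : signChange k * signChange k = 1 :=
  Equiv.swap_mul_self _ _

theorem signChange_mem (k : Fin n) : signChange k ∈ typeBGroup n := fun i s => by
  simp only [signChange_apply]
  split_ifs <;> rfl

theorem gen_eq_signChange {k : Fin n} (hk : k.val = 0) : gen k = signChange k := if_pos hk

theorem gen_eq_unsigned_swap {i j : Fin n} (hij : i ⋖ j) : gen j = unsigned (swap i j) := by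
  have hval : i.val + 1 = j.val := by simpa using hij
  have hi : i = ⟨j.val - 1, by omega⟩ := Fin.ext (by simp only; omega)
  rw [hi, gen, if_neg (by omega)]
  rfl

theorem exists_gen_eq_unsigned_swap {j : Fin n} (hj : j.val ≠ 0) :
    ∃ i, i ⋖ j ∧ gen j = unsigned (swap i j) := by
  have hij : (⟨j.val - 1, by omega⟩ : Fin n) ⋖ j := by
    rw [Fin.covBy_iff, Nat.covBy_iff_add_one_eq]
    simp only
    omega
  exact ⟨_, hij, gen_eq_unsigned_swap hij⟩

theorem gen_mul_self (i : Fin n) : gen i * gen i = 1 := by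
  by_cases hi : i.val = 0
  · rw [gen_eq_signChange hi, signChange_mul_self]
  · obtain ⟨j, -, hj⟩ := exists_gen_eq_unsigned_swap hi
    rw [hj, ← map_mul, Equiv.swap_mul_self, map_one]

theorem gen_inv (i : Fin n) : (gen i)⁻¹ = gen i := inv_eq_of_mul_eq_one_left (gen_mul_self i)

theorem prod_map_gen_reverse (w : List (Fin n)) :
    (w.reverse.map gen).prod = (w.map gen).prod⁻¹ := by
  simp [List.prod_inv_reverse, List.map_reverse, Function.comp_def, gen_inv]

theorem exists_word_unsigned (τ : Perm (Fin n)) :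
    ∃ w : List (Fin n), (w.map gen).prod = unsigned τ ∧ w.length = inversions τ := by
  induction h : inversions τ generalizing τ with
  | zero =>
    have hτ : τ = 1 := by
      by_contra hτ
      obtain ⟨i, j, hij, hlt⟩ := exists_descent hτ
      have := inversions_mul_swap_of_gt τ hij hlt
      omega
    exact ⟨[], by rw [hτ, map_one]; rfl, rfl⟩
  | succ k ih =>
    have hτ : τ ≠ 1 := by
      rintro rfl
      rw [inversions_one] at h
      omega
    obtain ⟨i, j, hij, hlt⟩ := exists_descent hτ
    have := inversions_mul_swap_of_gt τ hij hlt
    obtain ⟨w, hw, hlength⟩ := ih (τ * swap i j) (by omega)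
    refine ⟨w ++ [j], ?_, by simp [hlength]⟩
    rw [List.map_append, List.prod_append, hw, List.map_singleton, List.prod_singleton,
      gen_eq_unsigned_swap hij, ← map_mul, mul_assoc, Equiv.swap_mul_self, mul_one]

theorem unsigned_mem_closure (τ : Perm (Fin n)) :
    unsigned τ ∈ Submonoid.closure (Set.range gen) := by
  obtain ⟨w, hw, -⟩ := exists_word_unsigned τ
  rw [← hw]
  exact Submonoid.list_prod_mem _ fun σ hσ => by
    obtain ⟨i, -, rfl⟩ := List.mem_map.mp hσ
    exact Submonoid.subset_closure ⟨i, rfl⟩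

theorem signChange_mem_closure (k : Fin n) :
    signChange k ∈ Submonoid.closure (Set.range gen) := by
  let first : Fin n := ⟨0, k.pos⟩
  have hconj : signChange k =
      unsigned (swap first k) * gen first * (unsigned (swap first k))⁻¹ := by
    rw [gen_eq_signChange rfl, signChange, signChange, ← Equiv.swap_apply_apply, unsigned_apply,
      unsigned_apply, Equiv.swap_apply_left]
  rw [hconj, ← map_inv]
  exact mul_mem (mul_mem (unsigned_mem_closure _) (Submonoid.subset_closure ⟨first, rfl⟩))
    (unsigned_mem_closure _)

theorem eq_unsigned_absPerm (σ : typeBGroup n) (hσ : ∀ k, (σ.1 (k, 1)).2 = 1) :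
    σ.1 = unsigned (absPerm σ) := by
  have hpos (k : Fin n) : σ.1 (k, 1) = (absPerm σ k, 1) := Prod.ext rfl (hσ k)
  ext1 ⟨k, s⟩
  rcases Int.units_eq_one_or s with rfl | rfl
  · exact hpos k
  · rw [σ.2 k 1, hpos]
    rfl

theorem mem_closure_gen_of_sign_eq_one (s : Finset (Fin n)) {σ : Perm (SignedPoint n)}
    (hσ : σ ∈ typeBGroup n) (hs : ∀ k ∉ s, (σ (k, 1)).2 = 1) :
    σ ∈ Submonoid.closure (Set.range gen) := by
  induction s using Finset.induction_on generalizing σ with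
  | empty =>
    have hunsigned : σ = unsigned (absPerm ⟨σ, hσ⟩) :=
      eq_unsigned_absPerm ⟨σ, hσ⟩ fun k => hs k (Finset.notMem_empty k)
    rw [hunsigned]
    exact unsigned_mem_closure _
  | insert k s _ ih =>
    by_cases hk : (σ (k, 1)).2 = 1
    · exact ih hσ fun i hi => by grind
    · have hmul : σ * signChange k ∈ Submonoid.closure (Set.range gen) := by
        refine ih (mul_mem hσ (signChange_mem k)) fun i hi => ?_
        rw [Perm.mul_apply, signChange_apply]
        split_ifs with hik
        · rw [hσ, hik, (Int.units_eq_one_or _).resolve_left hk, neg_neg]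
        · exact hs i (by simp [hik, hi])
      simpa only [mul_assoc, signChange_mul_self, mul_one] using
        mul_mem hmul (signChange_mem_closure k)

theorem exists_word {σ : Perm (SignedPoint n)} (hσ : σ ∈ typeBGroup n) :
    ∃ w : List (Fin n), (w.map gen).prod = σ := by
  have hmem := mem_closure_gen_of_sign_eq_one Finset.univ hσ fun k hk =>
    absurd (Finset.mem_univ k) hk
  rw [← FreeMonoid.mrange_lift] at hmem
  obtain ⟨w, hw⟩ := hmem
  exact ⟨w.toList, (FreeMonoid.lift_apply gen w).symm.trans hw⟩

theorem exists_isReducedWord {σ : Perm (SignedPoint n)} (hσ : σ ∈ typeBGroup n) :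
    ∃ w : List (Fin n), IsReducedWord w σ := by
  let words := {w : List (Fin n) | (w.map gen).prod = σ}
  have hne : words.Nonempty := exists_word hσ
  exact ⟨Function.argminOn List.length words hne, Function.argminOn_mem List.length words hne,
    fun v hv => Function.argminOn_le List.length words hv⟩

/-! ### The lengths `l₁` and `l₂` -/

theorem IsReducedWord.reverse {w : List (Fin n)} {σ : Perm (SignedPoint n)}
    (h : IsReducedWord w σ) : IsReducedWord w.reverse σ⁻¹ := by
  refine ⟨by rw [prod_map_gen_reverse, h.1], fun v hv => ?_⟩
  simpa using h.2 v.reverse (by rw [prod_map_gen_reverse, hv, inv_inv])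

theorem setOf_countP_isReducedWord_inv (σ : Perm (SignedPoint n)) (p : Fin n → Bool) :
    {c | ∃ w : List (Fin n), IsReducedWord w σ⁻¹ ∧ w.countP p = c} =
      {c | ∃ w : List (Fin n), IsReducedWord w σ ∧ w.countP p = c} := by
  ext c
  constructor
  · rintro ⟨w, hw, rfl⟩
    exact ⟨w.reverse, inv_inv σ ▸ hw.reverse, List.countP_reverse⟩
  · rintro ⟨w, hw, rfl⟩
    exact ⟨w.reverse, hw.reverse, List.countP_reverse⟩

theorem l₁_inv (σ : Perm (SignedPoint n)) : l₁ σ⁻¹ = l₁ σ := by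
  rw [l₁, setOf_countP_isReducedWord_inv, l₁]

theorem l₂_inv (σ : Perm (SignedPoint n)) : l₂ σ⁻¹ = l₂ σ := by
  rw [l₂, setOf_countP_isReducedWord_inv, l₂]

theorem exists_isReducedWord_l₁ {σ : Perm (SignedPoint n)} (hσ : σ ∈ typeBGroup n) :
    ∃ w, IsReducedWord w σ ∧ w.countP (fun i => i.val = 0) = l₁ σ :=
  let ⟨w, hw⟩ := exists_isReducedWord hσ
  Nat.sInf_mem (s := {c | ∃ w, IsReducedWord w σ ∧ w.countP (fun i => i.val = 0) = c})
    ⟨_, w, hw, rfl⟩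

theorem exists_isReducedWord_l₂ {σ : Perm (SignedPoint n)} (hσ : σ ∈ typeBGroup n) :
    ∃ w, IsReducedWord w σ ∧ w.countP (fun i => i.val ≠ 0) = l₂ σ :=
  let ⟨w, hw⟩ := exists_isReducedWord hσ
  Nat.sInf_mem (s := {c | ∃ w, IsReducedWord w σ ∧ w.countP (fun i => i.val ≠ 0) = c})
    ⟨_, w, hw, rfl⟩

theorem inversions_le_countP (w : List (Fin n)) :
    ∃ τ : Perm (Fin n), (∀ k s, ((w.map gen).prod (k, s)).1 = τ k) ∧
      inversions τ ≤ w.countP (fun i => i.val ≠ 0) := by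
  induction w using List.reverseRecOn with
  | nil => exact ⟨1, fun _ _ => rfl, by rw [inversions_one]; exact Nat.zero_le _⟩
  | append_singleton w j ih =>
    obtain ⟨τ, hτ, hle⟩ := ih
    simp only [List.map_append, List.prod_append, List.map_singleton, List.prod_singleton,
      List.countP_append, Perm.mul_apply]
    by_cases hj : j.val = 0
    · refine ⟨τ, fun k s => ?_, by omega⟩
      rw [gen_eq_signChange hj, signChange_apply, hτ]
    · obtain ⟨i, hij, hgen⟩ := exists_gen_eq_unsigned_swap hj
      refine ⟨τ * swap i j, fun k s => ?_, ?_⟩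
      · rw [hgen, unsigned_apply, hτ, Perm.mul_apply]
      · have := inversions_mul_swap_le τ hij
        rw [List.countP_singleton, if_pos (by simpa using hj)]
        omega

theorem IsReducedWord.countP_of_unsigned {τ : Perm (Fin n)} {w : List (Fin n)}
    (hw : IsReducedWord w (unsigned τ)) :
    w.countP (fun i => i.val = 0) = 0 ∧ w.countP (fun i => i.val ≠ 0) = inversions τ := by
  obtain ⟨v, hv, hlength⟩ := exists_word_unsigned τ
  obtain ⟨τ', hτ', hle⟩ := inversions_le_countP w
  obtain rfl : τ' = τ := Equiv.ext fun k => by rw [← hτ' k 1, hw.1, unsigned_apply]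
  have hmin := hw.2 v hv
  have hsplit : w.length = w.countP (fun i => i.val = 0) + w.countP (fun i => i.val ≠ 0) := by
    simpa using List.length_eq_countP_add_countP (l := w) (fun i => i.val = 0)
  omega

theorem l₁_unsigned (τ : Perm (Fin n)) : l₁ (unsigned τ) = 0 := by
  obtain ⟨w, hw, hcount⟩ := exists_isReducedWord_l₁ (unsigned_mem τ)
  rw [← hcount, hw.countP_of_unsigned.1]

theorem l₂_unsigned (τ : Perm (Fin n)) : l₂ (unsigned τ) = inversions τ := by
  obtain ⟨w, hw, hcount⟩ := exists_isReducedWord_l₂ (unsigned_mem τ)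
  rw [← hcount, hw.countP_of_unsigned.2]

theorem l₁_one : l₁ (1 : Perm (SignedPoint n)) = 0 := by rw [← map_one unsigned, l₁_unsigned]

theorem l₂_one : l₂ (1 : Perm (SignedPoint n)) = 0 := by
  rw [← map_one unsigned, l₂_unsigned, inversions_one]

theorem exists_unsigned_eq_of_l₁_eq_zero {σ : Perm (SignedPoint n)} (hσ : σ ∈ typeBGroup n)
    (h : l₁ σ = 0) : ∃ τ, unsigned τ = σ := by
  obtain ⟨w, hw, hcount⟩ := exists_isReducedWord_l₁ hσ
  rw [h, List.countP_eq_zero] at hcount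
  rw [← hw.1]
  change _ ∈ MonoidHom.mrange (unsigned (n := n))
  refine Submonoid.list_prod_mem _ fun ρ hρ => ?_
  obtain ⟨i, hi, rfl⟩ := List.mem_map.mp hρ
  obtain ⟨j, -, hgen⟩ := exists_gen_eq_unsigned_swap (by simpa using hcount i hi)
  exact ⟨swap j i, hgen.symm⟩

theorem eq_one_or_eq_gen_zero_of_l₂_eq_zero {σ : Perm (SignedPoint (n + 1))}
    (hσ : σ ∈ typeBGroup (n + 1)) (h : l₂ σ = 0) : σ = 1 ∨ σ = gen 0 := by
  obtain ⟨w, hw, hcount⟩ := exists_isReducedWord_l₂ hσ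
  have hw0 : ∀ i ∈ w, i = 0 := fun i hi => by
    simpa using List.countP_eq_zero.mp (hcount.trans h) i hi
  rw [← hw.1, List.eq_replicate_of_mem hw0, List.map_replicate, List.prod_replicate]
  rcases w.length.even_or_odd with ⟨k, hk⟩ | ⟨k, hk⟩
  · exact .inl (by rw [hk, ← two_mul, pow_mul, sq, gen_mul_self, one_pow])
  · exact .inr (by rw [hk, pow_succ, pow_mul, sq, gen_mul_self, one_pow, one_mul])

theorem gen_zero_mem : gen (0 : Fin (n + 1)) ∈ typeBGroup (n + 1) :=
  gen_eq_signChange (Fin.val_zero (n + 1)) ▸ signChange_mem 0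

theorem gen_zero_ne_unsigned (τ : Perm (Fin (n + 1))) :
    gen (0 : Fin (n + 1)) ≠ unsigned τ := fun h => by
  have h01 := DFunLike.congr_fun h ((0, 1) : SignedPoint (n + 1))
  rw [gen_eq_signChange (Fin.val_zero _), signChange_apply, unsigned_apply, if_pos rfl] at h01
  exact absurd (congrArg Prod.snd h01) (show (-1 : ℤˣ) ≠ 1 by decide)

theorem IsReducedWord.eq_of_gen_zero {w : List (Fin (n + 1))}
    (hw : IsReducedWord w (gen (0 : Fin (n + 1)))) : w = [0] := by
  have hle : w.length ≤ 1 := hw.2 [0] (by simp)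
  match w, hw with
  | [], hw =>
    exact absurd (hw.1.symm.trans (map_one unsigned).symm) (gen_zero_ne_unsigned 1)
  | [i], hw =>
    by_contra hi
    obtain ⟨j, -, hgen⟩ := exists_gen_eq_unsigned_swap (j := i) (by simpa using hi)
    exact gen_zero_ne_unsigned (swap j i) (by rw [← hgen, ← hw.1]; simp)
  | _ :: _ :: _, _ => simp at hle

theorem l₁_gen_zero : l₁ (gen (0 : Fin (n + 1))) = 1 := by
  obtain ⟨w, hw, hcount⟩ := exists_isReducedWord_l₁ (gen_zero_mem (n := n))
  rw [← hcount, hw.eq_of_gen_zero]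
  simp

theorem l₂_gen_zero : l₂ (gen (0 : Fin (n + 1))) = 0 := by
  obtain ⟨w, hw, hcount⟩ := exists_isReducedWord_l₂ (gen_zero_mem (n := n))
  rw [← hcount, hw.eq_of_gen_zero]
  simp

end Words

variable {H : Type*} [NormedAddCommGroup H] [InnerProductSpace ℂ H]

/-! ### The symmetrization operator in the cases `α = 0` and `q = 0` -/

section Symmetrizer

variable {n : ℕ} (α q : ℝ) (J : H →ₗ[ℂ] H)

theorem symmetrizer_zero_left_tprod (x : Fin n → H) :
    symmetrizer 0 q J n (tprod ℂ x) =
      ∑ τ : Perm (Fin n), (q : ℂ) ^ inversions τ • tprod ℂ (x ∘ τ) := by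
  rw [symmetrizer, LinearMap.sum_apply]
  refine (Finset.sum_of_injOn (fun τ => ⟨unsigned τ⁻¹, unsigned_mem τ⁻¹⟩) ?_ (fun _ _ => by simp)
    ?_ ?_).symm
  · intro τ _ τ' _ h
    exact inv_injective (unsigned_injective (congrArg Subtype.val h))
  · intro σ _ hσ
    have hl₁ : l₁ σ.1 ≠ 0 := fun h => by
      obtain ⟨τ, hτ⟩ := exists_unsigned_eq_of_l₁_eq_zero σ.2 h
      exact hσ ⟨τ⁻¹, by simp, Subtype.ext (by simpa only [inv_inv] using hτ)⟩
    simp [hl₁]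
  · intro τ _
    rw [LinearMap.smul_apply, action_tprod, l₁_unsigned, l₂_unsigned, inversions_inv, pow_zero,
      one_mul]
    congr 2

theorem action_one : action J (1 : typeBGroup n) = LinearMap.id := by
  ext x
  rw [LinearMap.compMultilinearMap_apply, action_tprod]
  rfl

theorem action_gen_zero :
    action J ⟨gen (0 : Fin (n + 1)), gen_zero_mem⟩ = firstInvolution J (n + 1) := by
  ext x
  rw [LinearMap.compMultilinearMap_apply, LinearMap.compMultilinearMap_apply, action_tprod,
    firstInvolution, PiTensorProduct.map_tprod]
  congr 1
  funext j
  rw [gen_inv, gen_eq_signChange (Fin.val_zero (n + 1)), signChange_apply]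
  by_cases hj : j = 0
  · subst hj
    simp
  · simp [hj]

theorem symmetrizer_deg_zero : symmetrizer α q J 0 = LinearMap.id := by
  rw [symmetrizer, Fintype.sum_subsingleton _ 1, action_one]
  simp [l₁_one, l₂_one]

theorem symmetrizer_zero_right_succ :
    symmetrizer α 0 J (n + 1) = LinearMap.id + (α : ℂ) • firstInvolution J (n + 1) := by
  classical
  let π₀ : typeBGroup (n + 1) := ⟨gen 0, gen_zero_mem⟩
  have hne : 1 ≠ π₀ := fun h =>
    gen_zero_ne_unsigned 1 ((congrArg Subtype.val h).symm.trans (map_one unsigned).symm)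
  have hzero (σ : typeBGroup (n + 1)) (hσ : σ ∉ ({1, π₀} : Finset _)) : l₂ σ.1 ≠ 0 := fun h => by
    simp only [Finset.mem_insert, Finset.mem_singleton, not_or] at hσ
    rcases eq_one_or_eq_gen_zero_of_l₂_eq_zero σ.2 h with h | h
    · exact hσ.1 (Subtype.ext h)
    · exact hσ.2 (Subtype.ext h)
  rw [symmetrizer, ← Finset.sum_subset (Finset.subset_univ {1, π₀})
    fun σ _ hσ => by simp [hzero σ hσ], Finset.sum_pair hne, action_one, action_gen_zero]
  simp [π₀, l₁_one, l₂_one, l₁_gen_zero, l₂_gen_zero]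

theorem firstInvolution_tprod (x : Fin n → H) :
    firstInvolution J n (tprod ℂ x) = tprod ℂ fun i => if i.val = 0 then J (x i) else x i := by
  rw [firstInvolution, PiTensorProduct.map_tprod]
  congr 1
  funext j
  split_ifs <;> rfl

end Symmetrizer

/-! ### Symmetry of the symmetrization operator -/

section TensorInner

variable {n : ℕ}

theorem sesquilinear_ext {B B' : (⨂[ℂ]^n H) →ₗ⋆[ℂ] (⨂[ℂ]^n H) →ₗ[ℂ] ℂ}
    (h : ∀ x y : Fin n → H, B (tprod ℂ x) (tprod ℂ y) = B' (tprod ℂ x) (tprod ℂ y)) :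
    B = B' :=
  LinearMap.ext fun ξ => PiTensorProduct.ext <| MultilinearMap.ext fun y =>
    congrArg (· ξ) (antilinear_ext (f := B.flip (tprod ℂ y)) (g := B'.flip (tprod ℂ y))
      fun x => h x y)

theorem tensorInner_conj_symm (ξ η : ⨂[ℂ]^n H) :
    starRingEnd ℂ (tensorInner n ξ η) = tensorInner n η ξ := by
  induction ξ using PiTensorProduct.induction_on with
  | smul_tprod r x =>
    induction η using PiTensorProduct.induction_on with
    | smul_tprod s y =>
      simp only [map_smulₛₗ, LinearMap.smul_apply, tensorInner_tprod, smul_eq_mul,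
        map_mul, map_prod, inner_conj_symm, RingHom.id_apply, Complex.conj_conj]
      ring
    | add a b ha hb => rw [map_add, map_add, ha, hb, map_add, LinearMap.add_apply]
  | add a b ha hb => rw [map_add, LinearMap.add_apply, map_add, ha, hb, map_add]

theorem inv_apply_absPerm (σ : typeBGroup n) (k : Fin n) :
    σ.1⁻¹ (absPerm σ k, 1) = (k, (σ.1 (k, 1)).2) := by
  have hσ : σ.1 (k, 1) = (absPerm σ k, (σ.1 (k, 1)).2) := rfl
  rw [Perm.inv_eq_iff_eq]
  rcases Int.units_eq_one_or (σ.1 (k, 1)).2 with hs | hs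
  · rw [hs] at hσ ⊢
    exact hσ.symm
  · rw [hs, σ.2 k 1, hσ, hs, neg_neg]

variable {J : H →ₗ[ℂ] H}

theorem tensorInner_action (hJ : J.IsSymmetric) (σ : typeBGroup n) (ξ η : ⨂[ℂ]^n H) :
    tensorInner n (action J σ ξ) η = tensorInner n ξ (action J σ⁻¹ η) := by
  suffices h : (tensorInner n).comp (action J σ) =
      (LinearMap.lcomp ℂ ℂ (action J σ⁻¹)).comp (tensorInner n) from
    LinearMap.congr_fun (LinearMap.congr_fun h ξ) η
  refine sesquilinear_ext fun x y => ?_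
  simp only [LinearMap.comp_apply, LinearMap.lcomp_apply, action_tprod, tensorInner_tprod,
    Subgroup.coe_inv, inv_inv]
  refine (Fintype.prod_equiv (absPerm σ) _ _ fun k => ?_).symm
  rw [inv_apply_absPerm]
  split_ifs with hs
  · rfl
  · exact (hJ _ _).symm

theorem tensorInner_symmetrizer (hJ : J.IsSymmetric) (α q : ℝ) (ξ η : ⨂[ℂ]^n H) :
    tensorInner n (symmetrizer α q J n ξ) η = tensorInner n ξ (symmetrizer α q J n η) := by
  simp only [symmetrizer, LinearMap.sum_apply, LinearMap.smul_apply, map_sum, map_smulₛₗ,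
    tensorInner_action hJ]
  refine Fintype.sum_equiv (Equiv.inv _) _ _ fun σ => ?_
  simp only [Equiv.inv_apply, Subgroup.coe_inv, l₁_inv, l₂_inv, smul_eq_mul, map_mul, map_pow,
    Complex.conj_ofReal, RingHom.id_apply]

end TensorInner

/-! ### Extending a permutation by one point -/

section ExtendPerm

variable {n : ℕ}

/-- The permutation of `n + 1` points that sends the last point to `k` and acts as `τ` from the
remaining points to the points other than `k`, in increasing order. -/
def extendPerm (k : Fin (n + 1)) (τ : Perm (Fin n)) : Perm (Fin (n + 1)) :=
  (finSuccEquivLast.trans (Equiv.optionCongr τ)).trans (finSuccEquiv' k).symm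

@[simp]
theorem extendPerm_last (k : Fin (n + 1)) (τ : Perm (Fin n)) :
    extendPerm k τ (Fin.last n) = k := by
  simp [extendPerm]

@[simp]
theorem extendPerm_castSucc (k : Fin (n + 1)) (τ : Perm (Fin n)) (i : Fin n) :
    extendPerm k τ i.castSucc = k.succAbove (τ i) := by
  simp [extendPerm]

theorem extendPerm_bijective (n : ℕ) :
    Function.Bijective fun p : Fin (n + 1) × Perm (Fin n) => extendPerm p.1 p.2 := by
  rw [Fintype.bijective_iff_injective_and_card]
  refine ⟨?_, by simp [Fintype.card_perm, Nat.factorial_succ]⟩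
  rintro ⟨k, τ⟩ ⟨k', τ'⟩ (h : extendPerm k τ = extendPerm k' τ')
  obtain rfl : k = k' := by simpa using Equiv.congr_fun h (Fin.last n)
  have hτ : τ = τ' := Equiv.ext fun i => by simpa using Equiv.congr_fun h i.castSucc
  rw [hτ]

theorem comp_extendPerm {α : Type*} (b : Fin (n + 1) → α) (k : Fin (n + 1)) (τ : Perm (Fin n)) :
    b ∘ extendPerm k τ = Fin.snoc (α := fun _ => α) (k.removeNth b ∘ τ) (b k) := by
  funext i
  refine Fin.lastCases ?_ (fun i => ?_) i <;> simp [Fin.removeNth]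

theorem card_filter_lt_succAbove (k : Fin (n + 1)) :
    #{j : Fin n | k < k.succAbove j} = n - k := by
  simp only [Fin.lt_succAbove_iff_le_castSucc, Fin.le_def, Fin.val_castSucc]
  rw [Finset.card_filter, Fin.sum_univ_eq_sum_range (fun j => if k.val ≤ j then 1 else 0) n,
    ← Finset.card_filter, Finset.range_eq_Ico, Finset.Ico_filter_le, Nat.card_Ico, Nat.zero_max]

theorem inversions_eq_sum {ι : Type*} [Fintype ι] [LinearOrder ι] (τ : Perm ι) :
    inversions τ = ∑ i, ∑ j, if i < j ∧ τ j < τ i then 1 else 0 := by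
  rw [inversions, Finset.card_filter, Fintype.sum_prod_type]

theorem inversions_extendPerm (k : Fin (n + 1)) (τ : Perm (Fin n)) :
    inversions (extendPerm k τ) = n - k + inversions τ := by
  have hlast : ∑ i, (if k < k.succAbove (τ i) then 1 else 0) = n - k := by
    rw [Equiv.sum_comp τ fun j => if k < k.succAbove j then 1 else 0, ← Finset.card_filter,
      card_filter_lt_succAbove]
  have hle (i : Fin n) : ¬ Fin.last n < i.castSucc := (Fin.le_last _).not_gt
  simp only [inversions_eq_sum, Fin.sum_univ_castSucc, extendPerm_castSucc, extendPerm_last,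
    Fin.castSucc_lt_castSucc_iff, Fin.succAbove_lt_succAbove_iff, Fin.castSucc_lt_last, hle,
    lt_self_iff_false, true_and, false_and, if_false, Finset.sum_const_zero, add_zero,
    Finset.sum_add_distrib, hlast]
  exact add_comm _ _

end ExtendPerm

/-! ### Contractions -/

section Contract

variable (α q : ℝ) (J : H →ₗ[ℂ] H) {n : ℕ}

/-- The contraction `x₀ ⊗ ⋯ ⊗ x_n ↦ ⟨y, x_k⟩ x₀ ⊗ ⋯ ⊗ x_{k-1} ⊗ x_{k+1} ⊗ ⋯ ⊗ x_n`. -/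
def contract (y : H) (k : Fin (n + 1)) : (⨂[ℂ]^(n + 1) H) →ₗ[ℂ] (⨂[ℂ]^n H) :=
  PiTensorProduct.lift (LinearMap.uncurryMid k
    ((innerₛₗ ℂ y).smulRight (tprod ℂ (s := fun _ : Fin n => H))))

theorem contract_tprod (y : H) (k : Fin (n + 1)) (x : Fin (n + 1) → H) :
    contract y k (tprod ℂ x) = inner ℂ y (x k) • tprod ℂ (k.removeNth x) := by
  rw [contract, PiTensorProduct.lift.tprod]
  rfl

/-- The annihilation operator from degree `n + 1` to degree `n`:
`x₀ ⊗ ⋯ ⊗ x_n ↦ ∑ₖ (q^{n-k} ⟨y, x_k⟩ + α q^{n+k} ⟨J y, x_k⟩) x₀ ⊗ ⋯ x_{k-1} ⊗ x_{k+1} ⋯ ⊗ x_n`. -/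
def annihilateSucc (y : H) (n : ℕ) : (⨂[ℂ]^(n + 1) H) →ₗ[ℂ] (⨂[ℂ]^n H) :=
  ∑ k : Fin (n + 1),
    ((q : ℂ) ^ (n - k.val) • contract y k + ((α : ℂ) * q ^ (n + k.val)) • contract (J y) k)

theorem annihilateSucc_zero_left (y : H) :
    annihilateSucc 0 q J y n = ∑ k : Fin (n + 1), (q : ℂ) ^ (n - k.val) • contract y k := by
  simp [annihilateSucc]

theorem annihilateSucc_zero_right_zero (y : H) :
    annihilateSucc α 0 J y 0 = contract (y + (α : ℂ) • J y) 0 := by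
  ext x
  simp [annihilateSucc, contract_tprod, add_smul, mul_smul]

theorem annihilateSucc_zero_right_succ (y : H) :
    annihilateSucc α 0 J y (n + 1) = contract y (Fin.last (n + 1)) := by
  rw [annihilateSucc, Fintype.sum_eq_single (Fin.last (n + 1))]
  · simp
  · intro k hk
    have hk : n + 1 - k.val ≠ 0 := Nat.sub_ne_zero_of_lt (Fin.val_lt_last hk)
    simp [zero_pow hk]

theorem tensorInner_snoc (a b : Fin n → H) (x y : H) :
    tensorInner (n + 1) (tprod ℂ (Fin.snoc (α := fun _ => H) a x))
      (tprod ℂ (Fin.snoc (α := fun _ => H) b y)) =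
      inner ℂ x y * tensorInner n (tprod ℂ a) (tprod ℂ b) := by
  simp [tensorInner_tprod, Fin.prod_univ_castSucc, mul_comm]

theorem tensorInner_snoc_symmetrizer_zero_left (y : H) (a : Fin n → H) (b : Fin (n + 1) → H) :
    tensorInner (n + 1) (tprod ℂ (Fin.snoc (α := fun _ => H) a y))
        (symmetrizer 0 q J (n + 1) (tprod ℂ b)) =
      tensorInner n (tprod ℂ a) (symmetrizer 0 q J n (annihilateSucc 0 q J y n (tprod ℂ b))) := by
  simp only [annihilateSucc_zero_left, LinearMap.sum_apply, LinearMap.smul_apply, contract_tprod,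
    symmetrizer_zero_left_tprod, map_sum, map_smul, smul_eq_mul]
  rw [← (extendPerm_bijective n).sum_comp fun σ => (q : ℂ) ^ inversions σ *
      tensorInner (n + 1) (tprod ℂ (Fin.snoc (α := fun _ => H) a y)) (tprod ℂ (b ∘ σ)),
    Fintype.sum_prod_type]
  refine Finset.sum_congr rfl fun k _ => ?_
  simp only [Finset.mul_sum, comp_extendPerm, tensorInner_snoc, inversions_extendPerm, pow_add]
  exact Finset.sum_congr rfl fun τ _ => by ring

variable {J}

theorem tensorInner_snoc_symmetrizer_zero_right (hJ : J.IsSymmetric) (y : H) (a : Fin n → H)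
    (b : Fin (n + 1) → H) :
    tensorInner (n + 1) (tprod ℂ (Fin.snoc (α := fun _ => H) a y))
        (symmetrizer α 0 J (n + 1) (tprod ℂ b)) =
      tensorInner n (tprod ℂ a) (symmetrizer α 0 J n (annihilateSucc α 0 J y n (tprod ℂ b))) := by
  rcases n with _ | n
  · have ha : Fin.snoc (α := fun _ => H) a y 0 = y := Fin.snoc_last (α := fun _ => H) y a
    simp [annihilateSucc_zero_right_zero, symmetrizer_deg_zero, symmetrizer_zero_right_succ,
      firstInvolution_tprod, contract_tprod, tensorInner_tprod, ha, hJ y]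
  · simp only [annihilateSucc_zero_right_succ, symmetrizer_zero_right_succ, LinearMap.add_apply,
      LinearMap.smul_apply, LinearMap.id_apply, firstInvolution_tprod, contract_tprod,
      Fin.removeNth_last, Fin.init, map_add, map_smul, tensorInner_tprod,
      Fin.prod_univ_castSucc (n := n + 1), Fin.snoc_castSucc, Fin.snoc_last, Fin.val_castSucc,
      Fin.val_last, Nat.add_one_ne_zero, if_false, smul_eq_mul]
    ring

theorem tensorInner_snoc_symmetrizer (hJ : J.IsSymmetric) {α q : ℝ} (hαq : α * q = 0) (y : H)
    (a : Fin n → H) (b : Fin (n + 1) → H) :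
    tensorInner (n + 1) (tprod ℂ (Fin.snoc (α := fun _ => H) a y))
        (symmetrizer α q J (n + 1) (tprod ℂ b)) =
      tensorInner n (tprod ℂ a) (symmetrizer α q J n (annihilateSucc α q J y n (tprod ℂ b))) := by
  rcases mul_eq_zero.mp hαq with rfl | rfl
  · exact tensorInner_snoc_symmetrizer_zero_left q J y a b
  · exact tensorInner_snoc_symmetrizer_zero_right α hJ y a b

end Contract

/-! ### The deformed form on the Fock space -/

section FockForm

/-- The inclusion of `H^{⊗n}` into the Fock space. -/
abbrev fockOf (n : ℕ) : (⨂[ℂ]^n H) →ₗ[ℂ] Fock H :=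
  DirectSum.lof ℂ ℕ (fun n => ⨂[ℂ]^n H) n

theorem fockOf_apply_of_ne {m n : ℕ} (h : m ≠ n) (ξ : ⨂[ℂ]^n H) : fockOf n ξ m = 0 := by
  rw [DirectSum.lof_eq_of, DirectSum.of_eq_of_ne _ _ _ h]

theorem fock_induction {p : Fock H → Prop} (f : Fock H)
    (tprod : ∀ (n : ℕ) (a : Fin n → H), p (fockOf n (tprod ℂ a)))
    (add : ∀ f g, p f → p g → p (f + g)) (smul : ∀ (c : ℂ) f, p f → p (c • f)) : p f := by
  induction f using DirectSum.induction_on with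
  | zero => simpa only [zero_smul] using smul 0 _ (tprod 0 Fin.elim0)
  | of n ξ =>
    rw [← DirectSum.lof_eq_of ℂ]
    induction ξ using PiTensorProduct.induction_on with
    | smul_tprod r x => simpa only [map_smul] using smul r _ (tprod n x)
    | add a b ha hb => simpa only [map_add] using add _ _ ha hb
  | add a b ha hb => exact add _ _ ha hb

variable (α q : ℝ) (J : H →ₗ[ℂ] H)

theorem fockForm_fockOf_right (f : Fock H) {n : ℕ} (η : ⨂[ℂ]^n H) :
    fockForm α q J f (fockOf n η) = tensorInner n (f n) (symmetrizer α q J n η) := by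
  rw [fockForm, DirectSum.toModule_lof]
  rfl

theorem fockForm_fockOf_of_ne {m n : ℕ} (h : m ≠ n) (ξ : ⨂[ℂ]^m H) (η : ⨂[ℂ]^n H) :
    fockForm α q J (fockOf m ξ) (fockOf n η) = 0 := by
  rw [fockForm_fockOf_right, fockOf_apply_of_ne h.symm, map_zero, LinearMap.zero_apply]

theorem fockForm_add_right (f g g' : Fock H) :
    fockForm α q J f (g + g') = fockForm α q J f g + fockForm α q J f g' := map_add _ _ _

theorem fockForm_smul_right (c : ℂ) (f g : Fock H) :
    fockForm α q J f (c • g) = c * fockForm α q J f g := map_smul _ _ _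

theorem fockForm_add_left (f f' g : Fock H) :
    fockForm α q J (f + f') g = fockForm α q J f g + fockForm α q J f' g := by
  induction g using fock_induction with
  | tprod n a =>
    simp only [fockForm_fockOf_right, DirectSum.add_apply, map_add, LinearMap.add_apply]
  | add g g' hg hg' => simp only [fockForm_add_right, hg, hg', add_add_add_comm]
  | smul c g hg => simp only [fockForm_smul_right, hg, mul_add]

theorem fockForm_smul_left (c : ℂ) (f g : Fock H) :
    fockForm α q J (c • f) g = starRingEnd ℂ c * fockForm α q J f g := by
  induction g using fock_induction with
  | tprod n a =>
    rw [fockForm_fockOf_right, fockForm_fockOf_right, DirectSum.smul_apply, map_smulₛₗ,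
      LinearMap.smul_apply, smul_eq_mul]
  | add g g' hg hg' => simp only [fockForm_add_right, hg, hg', mul_add]
  | smul d g hg => rw [fockForm_smul_right, fockForm_smul_right, hg, mul_left_comm]

variable {J}

theorem fockForm_conj_symm (hJ : J.IsSymmetric) (f g : Fock H) :
    starRingEnd ℂ (fockForm α q J f g) = fockForm α q J g f := by
  induction f using fock_induction with
  | tprod m a =>
    induction g using fock_induction with
    | tprod n b =>
      rcases eq_or_ne m n with rfl | hmn
      · rw [fockForm_fockOf_right, fockForm_fockOf_right, DirectSum.lof_apply,
          DirectSum.lof_apply, tensorInner_conj_symm, tensorInner_symmetrizer hJ]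
      · rw [fockForm_fockOf_of_ne _ _ _ hmn, fockForm_fockOf_of_ne _ _ _ hmn.symm, map_zero]
    | add g g' hg hg' => rw [fockForm_add_right, fockForm_add_left, map_add, hg, hg']
    | smul c g hg => rw [fockForm_smul_right, fockForm_smul_left, map_mul, hg]
  | add f f' hf hf' => rw [fockForm_add_right, fockForm_add_left, map_add, hf, hf']
  | smul c f hf => rw [fockForm_smul_right, fockForm_smul_left, map_mul, hf, Complex.conj_conj]

end FockForm

/-! ### Adjoints of the creation operators -/

section Annihilate

variable (α q : ℝ) (J : H →ₗ[ℂ] H) (y : H) {n : ℕ}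

/-- The annihilation operator `∑ₙ annihilateSucc α q J y n`, which vanishes on the vacuum. It is
defined by a formula, and is one of the possibly many adjoints of `creation y`. -/
def annihilate : Module.End ℂ (Fock H) :=
  DirectSum.toModule ℂ ℕ _ fun
    | 0 => 0
    | n + 1 => fockOf n ∘ₗ annihilateSucc α q J y n

theorem annihilate_fockOf_zero (ξ : ⨂[ℂ]^0 H) : annihilate α q J y (fockOf 0 ξ) = 0 := by
  rw [annihilate, DirectSum.toModule_lof]
  rfl

theorem annihilate_fockOf_succ (ξ : ⨂[ℂ]^(n + 1) H) :
    annihilate α q J y (fockOf (n + 1) ξ) = fockOf n (annihilateSucc α q J y n ξ) := by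
  rw [annihilate, DirectSum.toModule_lof]
  rfl

theorem creation_fockOf_tprod (a : Fin n → H) :
    creation y (fockOf n (tprod ℂ a)) =
      fockOf (n + 1) (tprod ℂ (Fin.snoc (α := fun _ => H) a y)) := by
  rw [creation, LinearMap.mulRight_apply, DirectSum.lof_eq_of, DirectSum.lof_eq_of,
    DirectSum.of_mul_of, TensorPower.tprod_mul_tprod, Fin.append_right_eq_snoc,
    DirectSum.lof_eq_of]

variable {α q J}

theorem isFockAdjoint_annihilate (hαq : α * q = 0) (hJ : J.IsSymmetric) :
    IsFockAdjoint α q J (creation y) (annihilate α q J y) := by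
  intro f g
  induction f using fock_induction with
  | add f f' hf hf' => rw [map_add, fockForm_add_left, hf, hf', fockForm_add_left]
  | smul c f hf => rw [map_smul, fockForm_smul_left, hf, fockForm_smul_left]
  | tprod m a =>
    induction g using fock_induction with
    | add g g' hg hg' => rw [map_add, fockForm_add_right, hg, hg', fockForm_add_right]
    | smul c g hg => rw [map_smul, fockForm_smul_right, hg, fockForm_smul_right]
    | tprod n b =>
      rw [creation_fockOf_tprod]
      rcases n with _ | n
      · rw [annihilate_fockOf_zero, fockForm_fockOf_of_ne _ _ _ m.succ_ne_zero]
        exact (map_zero _).symm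
      rw [annihilate_fockOf_succ]
      rcases eq_or_ne m n with rfl | hmn
      · rw [fockForm_fockOf_right, fockForm_fockOf_right, DirectSum.lof_apply,
          DirectSum.lof_apply, tensorInner_snoc_symmetrizer hJ hαq]
      · rw [fockForm_fockOf_of_ne _ _ _ hmn, fockForm_fockOf_of_ne _ _ _ (by simpa using hmn)]

theorem isFockAdjoint_annihilation (hαq : α * q = 0) (hJ : J.IsSymmetric) :
    IsFockAdjoint α q J (creation y) (annihilation α q J y) := by
  have hex : ∃ S, IsFockAdjoint α q J (creation y) S := ⟨_, isFockAdjoint_annihilate y hαq hJ⟩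
  rw [annihilation, dif_pos hex]
  exact hex.choose_spec

end Annihilate

/-! ### The radical of the form -/

section Radical

variable {α q : ℝ} {J : H →ₗ[ℂ] H} {T S S' : Module.End ℂ (Fock H)}

variable (α q J) in
/-- The vectors that the form pairs to `0` with every vector: adjoints with respect to the form
are unique only modulo this subspace. -/
def radical : Submodule ℂ (Fock H) where
  carrier := {h | ∀ f, fockForm α q J f h = 0}
  add_mem' := fun ha hb f => by rw [fockForm_add_right, ha, hb, add_zero]
  zero_mem' := fun _ => map_zero _
  smul_mem' := fun c g hg f => by rw [fockForm_smul_right, hg, mul_zero]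

theorem IsFockAdjoint.symm (hJ : J.IsSymmetric) (h : IsFockAdjoint α q J T S) :
    IsFockAdjoint α q J S T := fun f g => by
  rw [← fockForm_conj_symm α q hJ, ← h, fockForm_conj_symm α q hJ]

theorem IsFockAdjoint.apply_mem_radical (h : IsFockAdjoint α q J T S) {g : Fock H}
    (hg : g ∈ radical α q J) : S g ∈ radical α q J :=
  fun f => by rw [← h, hg]

theorem IsFockAdjoint.sub_mem_radical (h : IsFockAdjoint α q J T S)
    (h' : IsFockAdjoint α q J T S') (g : Fock H) : S g - S' g ∈ radical α q J := fun f => by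
  rw [sub_eq_add_neg, ← neg_one_smul ℂ (S' g), fockForm_add_right, fockForm_smul_right, ← h, ← h',
    neg_one_mul, add_neg_cancel]

end Radical

/-! ### Positivity -/

section Positivity

variable {n : ℕ}

theorem exists_finiteDimensional_map_subtype_eq (ξ : ⨂[ℂ]^n H) :
    ∃ (K : Submodule ℂ H) (ξ' : ⨂[ℂ]^n K), FiniteDimensional ℂ K ∧
      PiTensorProduct.map (fun _ => K.subtype) ξ' = ξ := by
  induction ξ using PiTensorProduct.induction_on with
  | smul_tprod r x =>
    refine ⟨Submodule.span ℂ (Set.range x), r • tprod ℂ fun i =>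
      ⟨x i, Submodule.subset_span ⟨i, rfl⟩⟩, FiniteDimensional.span_of_finite ℂ
      (Set.finite_range x), ?_⟩
    rw [map_smul, PiTensorProduct.map_tprod]
    rfl
  | add a b ha hb =>
    obtain ⟨K, a', hK, rfl⟩ := ha
    obtain ⟨L, b', hL, rfl⟩ := hb
    refine ⟨K ⊔ L, PiTensorProduct.map (fun _ => Submodule.inclusion le_sup_left) a' +
      PiTensorProduct.map (fun _ => Submodule.inclusion le_sup_right) b', inferInstance, ?_⟩
    rw [map_add, ← LinearMap.comp_apply, ← LinearMap.comp_apply, ← PiTensorProduct.map_comp,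
      ← PiTensorProduct.map_comp]
    rfl

theorem tensorInner_map_subtype (K : Submodule ℂ H) (ξ η : ⨂[ℂ]^n K) :
    tensorInner n (PiTensorProduct.map (fun _ => K.subtype) ξ)
      (PiTensorProduct.map (fun _ => K.subtype) η) = tensorInner n ξ η := by
  let T : (⨂[ℂ]^n K) →ₗ[ℂ] (⨂[ℂ]^n H) := PiTensorProduct.map (fun _ => K.subtype)
  suffices h : (LinearMap.lcomp ℂ ℂ T).comp ((tensorInner n).comp T) = tensorInner n from
    LinearMap.congr_fun (LinearMap.congr_fun h ξ) η
  refine sesquilinear_ext fun x y => ?_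
  simp [T, LinearMap.lcomp_apply, PiTensorProduct.map_tprod, tensorInner_tprod]

theorem tensorInner_tprod_orthonormal {ι : Type*} [DecidableEq ι] {b : ι → H}
    (hb : Orthonormal ℂ b) (p p' : Fin n → ι) :
    tensorInner n (tprod ℂ (b ∘ p)) (tprod ℂ (b ∘ p')) = if p = p' then 1 else 0 := by
  simp only [tensorInner_tprod, Function.comp_apply, orthonormal_iff_ite.mp hb,
    Finset.prod_ite_zero, Finset.mem_univ, true_imp_iff, Finset.prod_const_one, funext_iff]

theorem tensorInner_self_eq_sum {ι : Type*} [Fintype ι] (b : OrthonormalBasis ι ℂ H)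
    (ξ : ⨂[ℂ]^n H) :
    tensorInner n ξ ξ =
      ∑ p, (‖(Basis.piTensorProduct fun _ : Fin n => b.toBasis).repr ξ p‖ : ℂ) ^ 2 := by
  classical
  set B := Basis.piTensorProduct fun _ : Fin n => b.toBasis
  have hB (p p' : Fin n → ι) : tensorInner n (B p) (B p') = if p = p' then 1 else 0 := by
    simpa [B, Basis.piTensorProduct_apply, Function.comp_def] using
      tensorInner_tprod_orthonormal b.orthonormal p p'
  conv_lhs => rw [← B.sum_repr ξ]
  simp only [map_sum, LinearMap.sum_apply, map_smulₛₗ, LinearMap.smul_apply, hB, smul_eq_mul,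
    RingHom.id_apply, mul_ite, mul_one, mul_zero, Finset.sum_ite_eq',
    Finset.mem_univ, if_true, Complex.mul_conj']

theorem tensorInner_self_pos {ξ : ⨂[ℂ]^n H} (hξ : ξ ≠ 0) : 0 < tensorInner n ξ ξ := by
  obtain ⟨K, ξ', hK, rfl⟩ := exists_finiteDimensional_map_subtype_eq ξ
  rw [tensorInner_map_subtype, tensorInner_self_eq_sum (stdOrthonormalBasis ℂ K)]
  set B := Basis.piTensorProduct fun _ : Fin n => (stdOrthonormalBasis ℂ K).toBasis
  have hne : B.repr ξ' ≠ 0 := fun h => hξ <| by rw [B.repr.map_eq_zero_iff.mp h, map_zero]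
  obtain ⟨p, hp⟩ := Finsupp.ne_iff.mp hne
  have hpos : 0 < ∑ p, ‖B.repr ξ' p‖ ^ 2 :=
    Finset.sum_pos' (fun _ _ => sq_nonneg _) ⟨p, Finset.mem_univ p, pow_pos (norm_pos_iff.mpr hp) 2⟩
  exact_mod_cast hpos

theorem tensorInner_self_nonneg (ξ : ⨂[ℂ]^n H) : 0 ≤ tensorInner n ξ ξ := by
  rcases eq_or_ne ξ 0 with rfl | h
  · rw [map_zero]
  · exact (tensorInner_self_pos h).le

variable {J : H →ₗ[ℂ] H}

theorem firstInvolution_involutive (hJ : Function.Involutive J) :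
    Function.Involutive (firstInvolution J n) := fun ξ => by
  suffices h : firstInvolution J n ∘ₗ firstInvolution J n = LinearMap.id from
    LinearMap.congr_fun h ξ
  ext x
  simp only [LinearMap.compMultilinearMap_apply, LinearMap.comp_apply, firstInvolution_tprod,
    LinearMap.id_apply]
  congr 1
  funext i
  split_ifs
  · exact hJ _
  · rfl

theorem tensorInner_firstInvolution (hJ : J.IsSymmetric) (ξ η : ⨂[ℂ]^(n + 1) H) :
    tensorInner (n + 1) (firstInvolution J (n + 1) ξ) η =
      tensorInner (n + 1) ξ (firstInvolution J (n + 1) η) := by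
  rw [← action_gen_zero, tensorInner_action hJ]
  have hinv : (⟨gen 0, gen_zero_mem⟩ : typeBGroup (n + 1))⁻¹ = ⟨gen 0, gen_zero_mem⟩ :=
    Subtype.ext (gen_inv 0)
  rw [hinv]

-- `ξ + π₀ ξ` and `ξ - π₀ ξ` are eigenvectors of `1 + α π₀` for the eigenvalues `1 + α`, `1 - α`.
theorem tensorInner_symmetrizer_zero_right_self (α : ℝ) (hJ : Function.Involutive J)
    (hJsym : J.IsSymmetric) (ξ : ⨂[ℂ]^(n + 1) H) :
    tensorInner (n + 1) ξ (symmetrizer α 0 J (n + 1) ξ) =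
      (((1 + α) / 4 : ℝ) : ℂ) * tensorInner (n + 1) (ξ + firstInvolution J (n + 1) ξ)
        (ξ + firstInvolution J (n + 1) ξ) +
      (((1 - α) / 4 : ℝ) : ℂ) * tensorInner (n + 1) (ξ - firstInvolution J (n + 1) ξ)
        (ξ - firstInvolution J (n + 1) ξ) := by
  simp only [symmetrizer_zero_right_succ, map_add, map_sub, LinearMap.add_apply,
    LinearMap.sub_apply, LinearMap.smul_apply, LinearMap.id_apply, map_smul,
    tensorInner_firstInvolution hJsym, firstInvolution_involutive hJ ξ, smul_eq_mul]
  push_cast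
  ring

theorem tensorInner_symmetrizer_zero_right_pos {α : ℝ} (hα : -1 < α) (hα' : α < 1)
    (hJ : Function.Involutive J) (hJsym : J.IsSymmetric) {ξ : ⨂[ℂ]^(n + 1) H} (hξ : ξ ≠ 0) :
    0 < tensorInner (n + 1) ξ (symmetrizer α 0 J (n + 1) ξ) := by
  rw [tensorInner_symmetrizer_zero_right_self α hJ hJsym]
  set η := firstInvolution J (n + 1) ξ
  have hadd : (0 : ℂ) < (((1 + α) / 4 : ℝ) : ℂ) := by
    exact_mod_cast (by linarith : (0 : ℝ) < (1 + α) / 4)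
  have hsub : (0 : ℂ) < (((1 - α) / 4 : ℝ) : ℂ) := by
    exact_mod_cast (by linarith : (0 : ℝ) < (1 - α) / 4)
  by_cases h : ξ + η = 0
  · have h' : ξ - η ≠ 0 := fun h' => hξ <| by
      have h2 : (2 : ℂ) • ξ = 0 := by
        rw [two_smul, ← add_add_sub_cancel ξ ξ η, h, h', add_zero]
      exact (smul_eq_zero.mp h2).resolve_left two_ne_zero
    exact add_pos_of_nonneg_of_pos (mul_nonneg hadd.le (tensorInner_self_nonneg _))
      (mul_pos hsub (tensorInner_self_pos h'))
  · exact add_pos_of_pos_of_nonneg (mul_pos hadd (tensorInner_self_pos h))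
      (mul_nonneg hsub.le (tensorInner_self_nonneg _))

theorem firstInvolution_eq_self_of_mem_span {ξ : ⨂[ℂ]^n H}
    (hξ : ξ ∈ Submodule.span ℂ {η | ∃ y : Fin n → H, (∀ i, J (y i) = y i) ∧ tprod ℂ y = η}) :
    firstInvolution J n ξ = ξ := by
  induction hξ using Submodule.span_induction with
  | mem η h =>
    obtain ⟨y, hy, rfl⟩ := h
    simp only [firstInvolution_tprod, hy, ite_self]
  | zero => rw [map_zero]
  | add a b _ _ ha hb => rw [map_add, ha, hb]
  | smul c a _ ha => rw [map_smul, ha]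

theorem tensorInner_symmetrizer_zero_right_pos_of_mem_span {α : ℝ} (hα : -1 < α)
    {ξ : ⨂[ℂ]^(n + 1) H} (hmem : ξ ∈ Submodule.span ℂ
      {η | ∃ y : Fin (n + 1) → H, (∀ i, J (y i) = y i) ∧ tprod ℂ y = η}) (hξ : ξ ≠ 0) :
    0 < tensorInner (n + 1) ξ (symmetrizer α 0 J (n + 1) ξ) := by
  have hpos : (0 : ℂ) < 1 + α := by exact_mod_cast (by linarith : (0 : ℝ) < 1 + α)
  rw [symmetrizer_zero_right_succ, LinearMap.add_apply, LinearMap.smul_apply,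
    firstInvolution_eq_self_of_mem_span hmem, map_add, map_smul, LinearMap.id_apply, smul_eq_mul,
    ← one_add_mul]
  exact mul_pos hpos (tensorInner_self_pos hξ)

end Positivity

/-! ### Annihilation operators on tensors indexed by finite sets -/

section Snoc

variable (α q : ℝ) (J : H →ₗ[ℂ] H) (x y : H) {n : ℕ}

theorem contract_last_snoc (a : Fin n → H) :
    contract y (Fin.last n) (tprod ℂ (Fin.snoc (α := fun _ => H) a x)) =
      inner ℂ y x • tprod ℂ a := by
  rw [contract_tprod, Fin.snoc_last, Fin.removeNth_last, Fin.init_snoc]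

theorem contract_castSucc_snoc (k : Fin (n + 1)) (a : Fin (n + 1) → H) :
    contract y k.castSucc (tprod ℂ (Fin.snoc (α := fun _ => H) a x)) =
      inner ℂ y (a k) • tprod ℂ (Fin.snoc (α := fun _ => H) (k.removeNth a) x) := by
  have hremove : k.castSucc.removeNth (Fin.snoc (α := fun _ => H) a x) =
      Fin.snoc (α := fun _ => H) (k.removeNth a) x := by
    funext i
    induction i using Fin.lastCases with
    | last =>
      rw [Fin.removeNth, Fin.succAbove_of_le_castSucc _ _ (Fin.castSucc_le_castSucc_iff.mpr
        k.le_last), Fin.succ_last, Fin.snoc_last, Fin.snoc_last]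
    | cast i =>
      rw [Fin.removeNth, Fin.castSucc_succAbove_castSucc, Fin.snoc_castSucc, Fin.snoc_castSucc]
      rfl
  rw [contract_tprod, Fin.snoc_castSucc, hremove]

theorem annihilate_creation_fockOf_tprod (a : Fin n → H) :
    annihilate α q J y (creation x (fockOf n (tprod ℂ a))) =
      (q : ℂ) • creation x (annihilate α q J y (fockOf n (tprod ℂ a))) +
        (inner ℂ y x + α * (q : ℂ) ^ (2 * n) * inner ℂ (J y) x) • fockOf n (tprod ℂ a) := by
  rw [creation_fockOf_tprod, annihilate_fockOf_succ, annihilateSucc, LinearMap.sum_apply,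
    Fin.sum_univ_castSucc, map_add]
  congr 1
  · rcases n with _ | n
    · simp only [annihilate_fockOf_zero, map_zero, smul_zero, Finset.univ_eq_empty,
        Finset.sum_empty]
    · rw [annihilate_fockOf_succ, annihilateSucc]
      simp only [LinearMap.sum_apply, LinearMap.add_apply, LinearMap.smul_apply,
        contract_castSucc_snoc]
      simp only [contract_tprod, map_sum, Finset.smul_sum, map_smul, creation_fockOf_tprod,
        Fin.val_castSucc, ← add_smul, smul_smul]
      refine Finset.sum_congr rfl fun k _ => ?_
      rw [show n + 1 - k.val = (n - k.val) + 1 by omega]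
      congr 1
      ring
  · simp only [LinearMap.add_apply, LinearMap.smul_apply, contract_last_snoc, map_smul, smul_smul,
      ← add_smul, Fin.val_last, Nat.sub_self, pow_zero, one_mul, two_mul]

end Snoc

section SetTensor

variable (α q : ℝ) (J : H →ₗ[ℂ] H) (y : H)
variable {ι : Type*} [LinearOrder ι] (x : ι → H) {j : ι} {s : Finset ι}

/-- The tensor product of the vectors `x i`, `i ∈ s`, in decreasing order of the indices. -/
def setTensor (s : Finset ι) : Fock H :=
  (s.sort (· ≤ ·)).foldr (fun i f => creation (x i) f) (vacuum H)

theorem setTensor_empty : setTensor x ∅ = vacuum H := by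
  rw [setTensor, Finset.sort_empty, List.foldr_nil]

theorem setTensor_insert (hj : ∀ i ∈ s, j < i) :
    setTensor x (insert j s) = creation (x j) (setTensor x s) := by
  rw [setTensor, Finset.sort_insert _ (fun i hi => (hj i hi).le) fun h => lt_irrefl _ (hj j h),
    List.foldr_cons, setTensor]

theorem exists_setTensor_eq (s : Finset ι) :
    ∃ a : Fin #s → H, setTensor x s = fockOf #s (tprod ℂ a) := by
  induction s using Finset.induction_on_min with
  | empty => exact ⟨Fin.elim0, setTensor_empty x⟩
  | insert j s hj ih =>
    obtain ⟨a, ha⟩ := ih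
    rw [Finset.card_insert_of_notMem fun h => lt_irrefl _ (hj j h), setTensor_insert x hj, ha,
      creation_fockOf_tprod]
    exact ⟨_, rfl⟩

theorem fockForm_vacuum_setTensor (s : Finset ι) :
    fockForm α q J (vacuum H) (setTensor x s) = if s = ∅ then 1 else 0 := by
  split_ifs with hs
  · rw [hs, setTensor_empty, vacuum, fockForm_fockOf_right, symmetrizer_deg_zero,
      DirectSum.lof_apply, LinearMap.id_apply, tensorInner_tprod, Fin.prod_univ_zero]
  · obtain ⟨a, ha⟩ := exists_setTensor_eq x s
    rw [ha, vacuum, fockForm_fockOf_of_ne _ _ _ (Finset.card_ne_zero.mpr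
      (Finset.nonempty_iff_ne_empty.mpr hs)).symm]

theorem annihilate_setTensor_insert (hj : ∀ i ∈ s, j < i) :
    annihilate α q J y (setTensor x (insert j s)) =
      (q : ℂ) • creation (x j) (annihilate α q J y (setTensor x s)) +
        (inner ℂ y (x j) + α * (q : ℂ) ^ (2 * #s) * inner ℂ (J y) (x j)) • setTensor x s := by
  obtain ⟨a, ha⟩ := exists_setTensor_eq x s
  rw [setTensor_insert x hj, ha, annihilate_creation_fockOf_tprod]

theorem annihilate_setTensor (s : Finset ι) :
    annihilate α q J y (setTensor x s) =
      ∑ k ∈ s, ((q : ℂ) ^ #{i ∈ s | i < k} * (inner ℂ y (x k) +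
        α * (q : ℂ) ^ (2 * #{i ∈ s | k < i}) * inner ℂ (J y) (x k))) •
          setTensor x (s.erase k) := by
  induction s using Finset.induction_on_min with
  | empty => rw [setTensor_empty, vacuum, annihilate_fockOf_zero, Finset.sum_empty]
  | insert j s hj ih =>
    have hjs : j ∉ s := fun h => lt_irrefl _ (hj j h)
    rw [annihilate_setTensor_insert α q J y x hj, Finset.sum_insert hjs, add_comm, ih, map_sum,
      Finset.smul_sum]
    congr 1
    · have hbelow : {i ∈ insert j s | i < j} = (∅ : Finset ι) := by
        grind
      have habove : {i ∈ insert j s | j < i} = s := by grind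
      rw [hbelow, habove, Finset.card_empty, pow_zero, one_mul, Finset.erase_insert hjs]
    · refine Finset.sum_congr rfl fun k hk => ?_
      have hjk := hj k hk
      have hbelow : {i ∈ insert j s | i < k} = insert j {i ∈ s | i < k} := by grind
      have habove : {i ∈ insert j s | k < i} = {i ∈ s | k < i} := by grind
      rw [hbelow, habove, Finset.card_insert_of_notMem (by grind), Finset.erase_insert_of_ne hjk.ne,
        setTensor_insert x fun i hi => hj i (Finset.mem_of_mem_erase hi), map_smul, smul_smul,
        pow_succ', mul_assoc (q : ℂ)]

end SetTensor

/-! ### Open matchings -/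

section Matchings

variable {ι : Type*} [LinearOrder ι]

/-- `M` is a matching of `s`: a partition of `s` into pairs, each recorded as `(i, k)` with
`i < k`. -/
structure IsMatching (M : Finset (ι × ι)) (s : Finset ι) : Prop where
  lt : ∀ p ∈ M, p.1 < p.2
  fst_mem : ∀ p ∈ M, p.1 ∈ s
  snd_mem : ∀ p ∈ M, p.2 ∈ s
  exists_mem : ∀ i ∈ s, ∃ p ∈ M, i = p.1 ∨ i = p.2
  eq_of_mem : ∀ p ∈ M, ∀ p' ∈ M, ∀ i, (i = p.1 ∨ i = p.2) → (i = p'.1 ∨ i = p'.2) → p = p'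

open Classical in
/-- The matchings of `r ∪ s` all of whose pairs have their smaller element in `r`. -/
def openMatchings (r s : Finset ι) : Finset (Finset (ι × ι)) :=
  {M ∈ ((r ∪ s) ×ˢ (r ∪ s)).powerset | IsMatching M (r ∪ s) ∧ ∀ p ∈ M, p.1 ∈ r}

/-- The crossings of a matching: the `(p, p')` for which the pairs `p` and `p'` cross and `p` starts
first. -/
def crossingPairs (M : Finset (ι × ι)) : Finset ((ι × ι) × (ι × ι)) :=
  {P ∈ M ×ˢ M | P.1.1 < P.2.1 ∧ P.2.1 < P.1.2 ∧ P.1.2 < P.2.2}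

/-- The inner pairs of a matching, i.e. those nested in another pair. -/
def innerPairs (M : Finset (ι × ι)) : Finset (ι × ι) :=
  {p ∈ M | ∃ p' ∈ M, p'.1 < p.1 ∧ p.2 < p'.2}

variable {r s : Finset ι} {j k : ι} {M : Finset (ι × ι)}

theorem mem_openMatchings :
    M ∈ openMatchings r s ↔ IsMatching M (r ∪ s) ∧ ∀ p ∈ M, p.1 ∈ r := by
  classical
  rw [openMatchings, Finset.mem_filter, Finset.mem_powerset, and_iff_right_iff_imp]
  exact fun h p hp => Finset.mem_product.mpr ⟨h.1.fst_mem p hp, h.1.snd_mem p hp⟩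

theorem mem_crossingPairs {P : (ι × ι) × (ι × ι)} :
    P ∈ crossingPairs M ↔
      (P.1 ∈ M ∧ P.2 ∈ M) ∧ P.1.1 < P.2.1 ∧ P.2.1 < P.1.2 ∧ P.1.2 < P.2.2 := by
  rw [crossingPairs, Finset.mem_filter, Finset.mem_product]

theorem openMatchings_empty_left :
    openMatchings ∅ s = if s = ∅ then {∅} else ∅ := by
  ext M
  rw [mem_openMatchings]
  split_ifs with hs
  · constructor
    · grind
    · rw [Finset.mem_singleton]
      rintro rfl
      exact ⟨by constructor <;> simp [hs], by simp⟩
  · obtain ⟨i, hi⟩ := Finset.nonempty_iff_ne_empty.mpr hs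
    refine iff_of_false (fun h => ?_) (Finset.notMem_empty _)
    obtain ⟨p, hp, -⟩ := h.1.exists_mem i (Finset.mem_union_right _ hi)
    exact Finset.notMem_empty _ (h.2 p hp)

theorem notMem_of_mem_openMatchings (hj : j ∉ r) (hM : M ∈ openMatchings r s) : (j, k) ∉ M :=
  fun h => hj ((mem_openMatchings.mp hM).2 _ h)

theorem mem_openMatchings_insert_right (hj : j ∉ r) :
    M ∈ openMatchings r (insert j s) ↔
      M ∈ openMatchings (insert j r) s ∧ ∀ p ∈ M, p.1 ≠ j := by
  rw [mem_openMatchings, mem_openMatchings, Finset.insert_union, Finset.union_insert]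
  grind

section Step

variable (hr : ∀ i ∈ r, i < j) (hs : ∀ i ∈ s, j < i)
include hr hs

theorem insert_mem_openMatchings (hk : k ∈ s) (hM : M ∈ openMatchings r (s.erase k)) :
    insert (j, k) M ∈ openMatchings (insert j r) s := by
  rw [mem_openMatchings] at hM ⊢
  obtain ⟨⟨hlt, hfst, hsnd, hex, heq⟩, hopen⟩ := hM
  have hjk := hs k hk
  have hfresh : ∀ p ∈ M, p.1 ≠ j ∧ p.1 ≠ k ∧ p.2 ≠ j ∧ p.2 ≠ k := by grind
  refine ⟨⟨?_, ?_, ?_, ?_, ?_⟩, ?_⟩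
  · grind
  · grind
  · grind
  · intro i hi
    by_cases hik : i = j ∨ i = k
    · exact ⟨(j, k), Finset.mem_insert_self _ _, hik⟩
    · obtain ⟨p, hp, hip⟩ := hex i (by grind)
      exact ⟨p, Finset.mem_insert_of_mem hp, hip⟩
  · intro p hp p' hp' i hi hi'
    rcases Finset.mem_insert.mp hp with rfl | hpM <;>
      rcases Finset.mem_insert.mp hp' with rfl | hpM'
    · rfl
    · grind
    · grind
    · exact heq p hpM p' hpM' i hi hi'
  · grind

theorem erase_mem_openMatchings (hM : M ∈ openMatchings (insert j r) s) (hp : (j, k) ∈ M) :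
    k ∈ s ∧ M.erase (j, k) ∈ openMatchings r (s.erase k) := by
  rw [mem_openMatchings] at hM ⊢
  obtain ⟨⟨hlt, -, hsnd, hex, heq⟩, hopen⟩ := hM
  have hjk := hlt _ hp
  have hfresh : ∀ p ∈ M.erase (j, k), p.1 ≠ j ∧ p.1 ≠ k ∧ p.2 ≠ j ∧ p.2 ≠ k := by
    intro p hp'
    have hne := Finset.ne_of_mem_erase hp'
    have h := heq p (Finset.mem_of_mem_erase hp') _ hp
    exact ⟨fun e => hne (h j (.inl e.symm) (.inl rfl)), fun e => hne (h k (.inl e.symm) (.inr rfl)),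
      fun e => hne (h j (.inr e.symm) (.inl rfl)), fun e => hne (h k (.inr e.symm) (.inr rfl))⟩
  refine ⟨by grind, ⟨?_, ?_, ?_, ?_, ?_⟩, ?_⟩
  · grind
  · grind
  · grind
  · intro i hi
    obtain ⟨p, hp, hip⟩ := hex i (by grind)
    exact ⟨p, by grind, hip⟩
  · exact fun p hp p' hp' => heq p (Finset.mem_of_mem_erase hp) p' (Finset.mem_of_mem_erase hp')
  · grind

theorem filter_openMatchings_insert_left :
    {M ∈ openMatchings (insert j r) s | ¬ ∀ p ∈ M, p.1 ≠ j} =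
      s.biUnion fun k => (openMatchings r (s.erase k)).image (insert (j, k)) := by
  ext M
  simp only [Finset.mem_filter, Finset.mem_biUnion, Finset.mem_image]
  constructor
  · rintro ⟨hM, h⟩
    push Not at h
    obtain ⟨⟨j', k⟩, hp, rfl⟩ := h
    obtain ⟨hk, hM'⟩ := erase_mem_openMatchings hr hs hM hp
    exact ⟨k, hk, _, hM', Finset.insert_erase hp⟩
  · rintro ⟨k, hk, M, hM, rfl⟩
    exact ⟨insert_mem_openMatchings hr hs hk hM, fun h => h _ (Finset.mem_insert_self _ _) rfl⟩

theorem sum_openMatchings_insert {A : Type*} [AddCommMonoid A] (F : Finset (ι × ι) → A) :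
    ∑ M ∈ openMatchings (insert j r) s, F M =
      ∑ M ∈ openMatchings r (insert j s), F M +
        ∑ k ∈ s, ∑ M ∈ openMatchings r (s.erase k), F (insert (j, k) M) := by
  have hjr : j ∉ r := fun h => lt_irrefl _ (hr j h)
  rw [← Finset.sum_filter_add_sum_filter_not _ (fun M => ∀ p ∈ M, p.1 ≠ j)]
  congr 1
  · refine Finset.sum_congr (Finset.ext fun M => ?_) fun _ _ => rfl
    rw [Finset.mem_filter, mem_openMatchings_insert_right hjr]
  · rw [filter_openMatchings_insert_left hr hs, Finset.sum_biUnion]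
    · refine Finset.sum_congr rfl fun k _ => Finset.sum_image fun M hM M' hM' h => ?_
      rw [← Finset.erase_insert (notMem_of_mem_openMatchings hjr hM), h,
        Finset.erase_insert (notMem_of_mem_openMatchings hjr hM')]
    · intro k hk k' _ hne
      refine Finset.disjoint_left.mpr fun M hM hM' => hne ?_
      obtain ⟨M₁, hM₁, rfl⟩ := Finset.mem_image.mp hM
      obtain ⟨M₂, -, h⟩ := Finset.mem_image.mp hM'
      have hmatch := (mem_openMatchings.mp (insert_mem_openMatchings hr hs hk hM₁)).1
      have hpair := hmatch.eq_of_mem (j, k) (Finset.mem_insert_self _ _) (j, k')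
        (h ▸ Finset.mem_insert_self _ _) j (Or.inl rfl) (Or.inl rfl)
      exact congrArg Prod.snd hpair

theorem card_filter_snd_lt (hM : M ∈ openMatchings r (s.erase k)) :
    #{p ∈ M | j < p.2 ∧ p.2 < k} = #{i ∈ s | i < k} := by
  obtain ⟨⟨-, -, hsnd, hex, heq⟩, hopen⟩ := mem_openMatchings.mp hM
  refine Finset.card_bij (fun p _ => p.2) ?_ ?_ ?_
  · grind
  · intro p hp p' hp' h
    exact heq p (Finset.mem_filter.mp hp).1 p' (Finset.mem_filter.mp hp').1 p.2 (.inr rfl) (.inr h)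
  · intro i hi
    obtain ⟨p, hp, hip⟩ := hex i (by grind)
    exact ⟨p, by grind, by grind⟩

theorem card_crossingPairs_insert (hM : M ∈ openMatchings r (s.erase k)) :
    #(crossingPairs (insert (j, k) M)) = #{i ∈ s | i < k} + #(crossingPairs M) := by
  have hopen := (mem_openMatchings.mp hM).2
  have hunion : crossingPairs (insert (j, k) M) =
      {p ∈ M | j < p.2 ∧ p.2 < k} ×ˢ {(j, k)} ∪ crossingPairs M := by
    grind [mem_crossingPairs]
  rw [hunion, Finset.card_union_of_disjoint, Finset.card_product, Finset.card_singleton, mul_one,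
    card_filter_snd_lt hr hs hM]
  grind [Finset.disjoint_left, mem_crossingPairs]

theorem card_innerPairs_insert (hk : k ∈ s) (hM : M ∈ openMatchings r (s.erase k)) :
    #(innerPairs (insert (j, k) M)) = (if ∃ i ∈ s, k < i then 1 else 0) + #(innerPairs M) := by
  have hnot : (j, k) ∉ M :=
    notMem_of_mem_openMatchings (fun h => lt_irrefl _ (hr j h)) hM
  obtain ⟨⟨-, -, hsnd, hex, -⟩, hopen⟩ := mem_openMatchings.mp hM
  have hinner : (∃ p' ∈ insert (j, k) M, p'.1 < j ∧ k < p'.2) ↔ ∃ i ∈ s, k < i := by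
    constructor
    · rintro ⟨p, hp, -, hkp⟩
      have hpM : p ∈ M := (Finset.mem_insert.mp hp).resolve_left (by grind)
      rcases Finset.mem_union.mp (hsnd p hpM) with hpr | hps
      · exact absurd (hr _ hpr) ((hs k hk).trans hkp).not_gt
      · exact ⟨p.2, Finset.mem_of_mem_erase hps, hkp⟩
    · rintro ⟨i, hi, hki⟩
      obtain ⟨p, hp, hip⟩ := hex i (by grind)
      have hpj : p.1 < j := hr _ (hopen p hp)
      have hip2 : i = p.2 := hip.resolve_left (hpj.trans (hs i hi)).ne'
      exact ⟨p, Finset.mem_insert_of_mem hp, hpj, hip2 ▸ hki⟩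
  have hrest : {p ∈ M | ∃ p' ∈ insert (j, k) M, p'.1 < p.1 ∧ p.2 < p'.2} =
      {p ∈ M | ∃ p' ∈ M, p'.1 < p.1 ∧ p.2 < p'.2} := by
    refine Finset.filter_congr fun p hp => ?_
    rw [Finset.exists_mem_insert, or_iff_right]
    exact fun h => lt_asymm h.1 (hr _ (hopen p hp))
  rw [innerPairs, innerPairs, Finset.filter_insert, hrest]
  simp only [hinner]
  split_ifs
  · rw [Finset.card_insert_of_notMem fun h => hnot (Finset.mem_filter.mp h).1, add_comm]
  · rw [zero_add]

end Step

/-- The weight of a matching in the moment formula. -/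
def matchingWeight {R : Type*} [CommSemiring R] (q t : R) (w : ι → ι → R)
    (M : Finset (ι × ι)) : R :=
  q ^ #(crossingPairs M) * t ^ #(innerPairs M) * ∏ p ∈ M, w p.1 p.2

theorem matchingWeight_insert {R : Type*} [CommSemiring R] (q t : R) (w : ι → ι → R)
    (hr : ∀ i ∈ r, i < j) (hs : ∀ i ∈ s, j < i) (hk : k ∈ s)
    (hM : M ∈ openMatchings r (s.erase k)) :
    matchingWeight q t w (insert (j, k) M) =
      q ^ #{i ∈ s | i < k} * t ^ (if ∃ i ∈ s, k < i then 1 else 0) * w j k *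
        matchingWeight q t w M := by
  rw [matchingWeight, card_crossingPairs_insert hr hs hM, card_innerPairs_insert hr hs hk hM,
    Finset.prod_insert (notMem_of_mem_openMatchings (fun h => lt_irrefl _ (hr j h)) hM),
    matchingWeight, pow_add, pow_add]
  ring

theorem sum_matchingWeight_of_recursion {R V : Type*} [CommSemiring R] [AddCommMonoid V]
    [Module R V] (g : ι → Module.End R V) (T : Finset ι → V) (φ : V →ₗ[R] R) (q t : R)
    (w : ι → ι → R) (hφ : ∀ s, φ (T s) = if s = ∅ then 1 else 0)
    (hg : ∀ j s, (∀ i ∈ s, j < i) → g j (T s) = T (insert j s) +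
      ∑ k ∈ s, (q ^ #{i ∈ s | i < k} * t ^ (if ∃ i ∈ s, k < i then 1 else 0) * w j k) •
        T (s.erase k))
    (L : List ι) (hL : L.Pairwise (· < ·)) (s : Finset ι) (hs : ∀ j ∈ L, ∀ i ∈ s, j < i) :
    φ ((L.map g).prod (T s)) = ∑ M ∈ openMatchings L.toFinset s, matchingWeight q t w M := by
  induction L using List.reverseRecOn generalizing s with
  | nil =>
    rw [List.toFinset_nil, openMatchings_empty_left, List.map_nil, List.prod_nil,
      Module.End.one_apply, hφ]
    split_ifs
    · simp [matchingWeight, crossingPairs, innerPairs]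
    · rw [Finset.sum_empty]
  | append_singleton L j ih =>
    obtain ⟨hL, -, hLj⟩ := List.pairwise_append.mp hL
    have hr : ∀ i ∈ L.toFinset, i < j := fun i hi => hLj i (List.mem_toFinset.mp hi) j (by simp)
    have hjs : ∀ i ∈ s, j < i := hs j (by simp)
    have hLs : ∀ i ∈ L, ∀ k ∈ s, i < k := fun i hi => hs i (by simp [hi])
    have htoFinset : (L ++ [j]).toFinset = insert j L.toFinset := by
      ext; simp
    rw [htoFinset, sum_openMatchings_insert hr hjs, List.map_append, List.prod_append,
      List.map_singleton, List.prod_singleton, Module.End.mul_apply, hg j s hjs, map_add, map_add,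
      map_sum, map_sum, ih hL (insert j s) (by grind)]
    congr 1
    refine Finset.sum_congr rfl fun k hk => ?_
    rw [map_smul, map_smul, ih hL (s.erase k) (by grind), smul_eq_mul, Finset.mul_sum]
    exact Finset.sum_congr rfl fun M hM => (matchingWeight_insert q t w hr hjs hk hM).symm

end Matchings

/-! ### Pair partitions as matchings -/

section PairPartitions

variable {n : ℕ} {π : Finpartition (Finset.univ : Finset (Fin n))} {p p' : Fin n × Fin n}

/-- The blocks `{i, j}` of `π` with two elements, recorded as pairs `(i, j)` with `i < j`. -/
def blockPairs (π : Finpartition (Finset.univ : Finset (Fin n))) : Finset (Fin n × Fin n) :=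
  {p | p.1 < p.2 ∧ {p.1, p.2} ∈ π.parts}

theorem mem_blockPairs : p ∈ blockPairs π ↔ p.1 < p.2 ∧ {p.1, p.2} ∈ π.parts := by
  rw [blockPairs, Finset.mem_filter_univ]

theorem mem_pairPartitions : π ∈ pairPartitions n ↔ ∀ V ∈ π.parts, #V = 2 := by
  rw [pairPartitions, Finset.mem_filter_univ]

theorem finset_pair_eq_pair_iff {α : Type*} [DecidableEq α] {a b c d : α} :
    ({a, b} : Finset α) = {c, d} ↔ a = c ∧ b = d ∨ a = d ∧ b = c := by
  rw [← Finset.coe_inj, Finset.coe_pair, Finset.coe_pair, Set.pair_eq_pair_iff]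

theorem eq_of_pair_eq_pair_of_lt {α : Type*} [LinearOrder α] {p p' : α × α} (hp : p.1 < p.2)
    (hp' : p'.1 < p'.2) (h : ({p.1, p.2} : Finset α) = {p'.1, p'.2}) : p = p' := by
  rcases finset_pair_eq_pair_iff.mp h with h | ⟨h₁, h₂⟩
  · exact Prod.ext h.1 h.2
  · exact absurd hp (h₁ ▸ h₂ ▸ hp'.not_gt)

theorem blockPairs_pair_injOn :
    Set.InjOn (fun p : Fin n × Fin n => ({p.1, p.2} : Finset (Fin n))) (blockPairs π) :=
  fun _ hp _ hp' => eq_of_pair_eq_pair_of_lt (mem_blockPairs.mp hp).1 (mem_blockPairs.mp hp').1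

theorem eq_pair_of_mem_parts (hπ : π ∈ pairPartitions n) {V : Finset (Fin n)} (hV : V ∈ π.parts)
    {i j : Fin n} (hi : i ∈ V) (hj : j ∈ V) (hij : i < j) :
    (i, j) ∈ blockPairs π ∧ V = {i, j} := by
  have hVij : {i, j} = V := by
    refine Finset.eq_of_subset_of_card_le (by grind) ?_
    rw [mem_pairPartitions.mp hπ V hV, Finset.card_pair hij.ne]
  exact ⟨mem_blockPairs.mpr ⟨hij, hVij ▸ hV⟩, hVij.symm⟩

theorem exists_mem_blockPairs_eq_pair (hπ : π ∈ pairPartitions n) {V : Finset (Fin n)}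
    (hV : V ∈ π.parts) : ∃ p ∈ blockPairs π, V = {p.1, p.2} := by
  obtain ⟨i, hi, j, hj, hij⟩ := Finset.one_lt_card.mp (by
    rw [mem_pairPartitions.mp hπ V hV]; exact one_lt_two : 1 < #V)
  rcases hij.lt_or_gt with h | h
  · exact ⟨(i, j), eq_pair_of_mem_parts hπ hV hi hj h⟩
  · exact ⟨(j, i), eq_pair_of_mem_parts hπ hV hj hi h⟩

theorem image_blockPairs (hπ : π ∈ pairPartitions n) :
    (blockPairs π).image (fun p => {p.1, p.2}) = π.parts := by
  ext V
  rw [Finset.mem_image]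
  constructor
  · rintro ⟨p, hp, rfl⟩
    exact (mem_blockPairs.mp hp).2
  · intro hV
    obtain ⟨p, hp, h⟩ := exists_mem_blockPairs_eq_pair hπ hV
    exact ⟨p, hp, h.symm⟩

theorem isMatching_blockPairs (hπ : π ∈ pairPartitions n) :
    IsMatching (blockPairs π) Finset.univ where
  lt p hp := (mem_blockPairs.mp hp).1
  fst_mem _ _ := Finset.mem_univ _
  snd_mem _ _ := Finset.mem_univ _
  exists_mem i hi := by
    obtain ⟨V, hV, hiV⟩ := π.exists_mem hi
    obtain ⟨p, hp, rfl⟩ := exists_mem_blockPairs_eq_pair hπ hV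
    exact ⟨p, hp, by simpa using hiV⟩
  eq_of_mem p hp p' hp' i hi hi' := blockPairs_pair_injOn hp hp'
    (π.eq_of_mem_parts (mem_blockPairs.mp hp).2 (mem_blockPairs.mp hp').2
      (by simpa using hi) (by simpa using hi'))

/-- The partition of `s` into the pairs of a matching of `s`. -/
def IsMatching.finpartition {ι : Type*} [LinearOrder ι] {M : Finset (ι × ι)} {s : Finset ι}
    (hM : IsMatching M s) : Finpartition s :=
  Finpartition.ofExistsUnique (M.image fun p => {p.1, p.2})
    (by
      intro V hV
      obtain ⟨p, hp, rfl⟩ := Finset.mem_image.mp hV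
      exact Finset.insert_subset (hM.fst_mem p hp)
        (Finset.singleton_subset_iff.mpr (hM.snd_mem p hp)))
    (by
      intro i hi
      obtain ⟨p, hp, hip⟩ := hM.exists_mem i hi
      refine ⟨{p.1, p.2}, ⟨Finset.mem_image_of_mem _ hp, by simpa using hip⟩, ?_⟩
      rintro V ⟨hV, hiV⟩
      obtain ⟨p', hp', rfl⟩ := Finset.mem_image.mp hV
      rw [hM.eq_of_mem p' hp' p hp i (by simpa using hiV) hip])
    (by simp)

theorem mem_openMatchings_univ_empty {M : Finset (Fin n × Fin n)} :
    M ∈ openMatchings Finset.univ ∅ ↔ IsMatching M Finset.univ := by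
  rw [mem_openMatchings, Finset.union_empty]
  exact and_iff_left fun _ _ => Finset.mem_univ _

theorem blockPairs_finpartition {M : Finset (Fin n × Fin n)} (hM : IsMatching M Finset.univ) :
    blockPairs hM.finpartition = M := by
  ext p
  rw [mem_blockPairs]
  constructor
  · rintro ⟨hlt, hp⟩
    obtain ⟨p', hp', h⟩ := Finset.mem_image.mp hp
    rwa [← eq_of_pair_eq_pair_of_lt (hM.lt p' hp') hlt h]
  · exact fun hp => ⟨hM.lt p hp, Finset.mem_image_of_mem _ hp⟩

theorem finpartition_mem_pairPartitions {M : Finset (Fin n × Fin n)}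
    (hM : IsMatching M Finset.univ) : hM.finpartition ∈ pairPartitions n := by
  refine mem_pairPartitions.mpr fun V hV => ?_
  obtain ⟨p, hp, rfl⟩ := Finset.mem_image.mp hV
  exact Finset.card_pair (hM.lt p hp).ne

theorem sum_pairPartitions {A : Type*} [AddCommMonoid A] (F : Finset (Fin n × Fin n) → A) :
    ∑ π ∈ pairPartitions n, F (blockPairs π) = ∑ M ∈ openMatchings Finset.univ ∅, F M := by
  refine Finset.sum_bij (fun π _ => blockPairs π)
    (fun π hπ => mem_openMatchings_univ_empty.mpr (isMatching_blockPairs hπ))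
    (fun π hπ π' hπ' h => ?_) (fun M hM => ?_) fun _ _ => rfl
  · ext1
    rw [← image_blockPairs hπ, h, image_blockPairs hπ']
  · rw [mem_openMatchings_univ_empty] at hM
    exact ⟨_, finpartition_mem_pairPartitions hM, blockPairs_finpartition hM⟩

theorem covers_pair_iff (hp : p.1 < p.2) (hp' : p'.1 < p'.2) :
    Covers {p'.1, p'.2} {p.1, p.2} ↔ p'.1 < p.1 ∧ p.2 < p'.2 := by
  simp only [Covers, Finset.exists_mem_insert, Finset.mem_singleton, exists_eq_left,
    Finset.forall_mem_insert, forall_eq]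
  grind

theorem card_innerPairs_blockPairs (hπ : π ∈ pairPartitions n) :
    #(innerPairs (blockPairs π)) = innerBlocks π := by
  classical
  rw [innerPairs, innerBlocks, ← image_blockPairs hπ, Finset.filter_image,
    Finset.card_image_of_injOn (blockPairs_pair_injOn.mono (Finset.filter_subset _ _))]
  refine congrArg _ (Finset.filter_congr fun p hp => ?_)
  rw [Finset.exists_mem_image]
  refine exists_congr fun p' => and_congr_right fun hp' => ?_
  rw [covers_pair_iff (mem_blockPairs.mp hp).1 (mem_blockPairs.mp hp').1]

theorem crossingPairs_pair_injOn :
    Set.InjOn (fun P : (Fin n × Fin n) × (Fin n × Fin n) =>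
        ({{P.1.1, P.1.2}, {P.2.1, P.2.2}} : Finset (Finset (Fin n))))
      (crossingPairs (blockPairs π)) := by
  intro P hP P' hP' h
  obtain ⟨⟨h₁, h₂⟩, hlt, -⟩ := mem_crossingPairs.mp hP
  obtain ⟨⟨h₁', h₂'⟩, hlt', -⟩ := mem_crossingPairs.mp hP'
  rcases finset_pair_eq_pair_iff.mp h with ⟨e₁, e₂⟩ | ⟨e₁, e₂⟩
  · exact Prod.ext (blockPairs_pair_injOn h₁ h₁' e₁) (blockPairs_pair_injOn h₂ h₂' e₂)
  · rw [blockPairs_pair_injOn h₁ h₂' e₁, blockPairs_pair_injOn h₂ h₁' e₂] at hlt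
    exact absurd hlt hlt'.not_gt

theorem card_crossingPairs_blockPairs (hπ : π ∈ pairPartitions n) :
    #(crossingPairs (blockPairs π)) = crossings π := by
  classical
  rw [crossings, ← Finset.card_image_of_injOn crossingPairs_pair_injOn]
  congr 1
  ext S
  rw [Finset.mem_image, Finset.mem_filter, Finset.mem_powersetCard]
  constructor
  · rintro ⟨P, hP, rfl⟩
    obtain ⟨⟨h₁, h₂⟩, hcross⟩ := mem_crossingPairs.mp hP
    have hne : ({P.1.1, P.1.2} : Finset (Fin n)) ≠ {P.2.1, P.2.2} := fun h =>
      hcross.1.ne (congrArg Prod.fst (blockPairs_pair_injOn h₁ h₂ h))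
    refine ⟨⟨?_, Finset.card_pair hne⟩, _, by simp, _, by simp, hne, P.1.1, by simp, P.1.2,
      by simp, P.2.1, by simp, P.2.2, by simp, hcross⟩
    exact Finset.insert_subset (mem_blockPairs.mp h₁).2
      (Finset.singleton_subset_iff.mpr (mem_blockPairs.mp h₂).2)
  · rintro ⟨⟨hS, hcard⟩, V, hV, W, hW, hne, i, hi, j, hj, k, hk, l, hl, hik, hkj, hjl⟩
    have hVW : {V, W} = S :=
      Finset.eq_of_subset_of_card_le (by grind) (by rw [hcard, Finset.card_pair hne])
    obtain ⟨hij, rfl⟩ := eq_pair_of_mem_parts hπ (hS hV) hi hj (hik.trans hkj)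
    obtain ⟨hkl, rfl⟩ := eq_pair_of_mem_parts hπ (hS hW) hk hl (hkj.trans hjl)
    exact ⟨((i, j), (k, l)), mem_crossingPairs.mpr ⟨⟨hij, hkl⟩, hik, hkj, hjl⟩, hVW⟩

theorem matchingWeight_blockPairs (hπ : π ∈ pairPartitions n) (q t : ℂ) (x : Fin n → H) :
    matchingWeight q t (fun i j => inner ℂ (x i) (x j)) (blockPairs π) =
      q ^ crossings π * t ^ innerBlocks π * pairProduct π x := by
  rw [matchingWeight, card_crossingPairs_blockPairs hπ, card_innerPairs_blockPairs hπ, pairProduct,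
    blockPairs]

end PairPartitions

/-! ### Moments of the Gaussian operators -/

section Moments

variable {ι : Type*} {α q : ℝ} {J : H →ₗ[ℂ] H}

theorem prod_gaussian_sub_mem_radical (hαq : α * q = 0) (hJ : J.IsSymmetric) (c : ℂ) (x : ι → H)
    (L : List ι) (v : Fock H) :
    (L.map fun i => c • gaussian α q J (x i)).prod v -
      (L.map fun i => c • (annihilate α q J (x i) + creation (x i))).prod v ∈ radical α q J := by
  induction L with
  | nil => simp
  | cons i L ih =>
    simp only [List.map_cons, List.prod_cons, Module.End.mul_apply]
    set u := (L.map fun i => c • gaussian α q J (x i)).prod v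
    set u' := (L.map fun i => c • (annihilate α q J (x i) + creation (x i))).prod v
    have hadj := isFockAdjoint_annihilation (x i) hαq hJ
    have hannihilation : annihilation α q J (x i) (u - u') ∈ radical α q J :=
      hadj.apply_mem_radical ih
    have hcreation : creation (x i) (u - u') ∈ radical α q J := (hadj.symm hJ).apply_mem_radical ih
    have hdiff : annihilation α q J (x i) u' - annihilate α q J (x i) u' ∈ radical α q J :=
      hadj.sub_mem_radical (isFockAdjoint_annihilate (x i) hαq hJ) u'
    convert (radical α q J).smul_mem c (add_mem (add_mem hannihilation hcreation) hdiff) using 1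
    rw [gaussian, LinearMap.smul_apply, LinearMap.smul_apply, ← smul_sub, LinearMap.add_apply,
      LinearMap.add_apply, map_sub, map_sub]
    congr 1
    abel

variable (α q J) in
/-- The linear functional `g ↦ ⟨Ω, g⟩_{α,q}`. -/
def vacuumFunctional : Fock H →ₗ[ℂ] ℂ where
  toFun := fockForm α q J (vacuum H)
  map_add' := fockForm_add_right α q J _
  map_smul' c := fockForm_smul_right α q J c _

theorem vacuumFunctional_eq_of_sub_mem_radical {f g : Fock H} (h : f - g ∈ radical α q J) :
    vacuumFunctional α q J f = vacuumFunctional α q J g := by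
  rw [← sub_eq_zero, ← map_sub]
  exact h _

variable [LinearOrder ι] {t c : ℝ}

theorem vacuumFunctional_pow_smul_setTensor (c : ℂ) (x : ι → H) (s : Finset ι) :
    vacuumFunctional α q J (c ^ #s • setTensor x s) = if s = ∅ then 1 else 0 := by
  have happly : vacuumFunctional α q J (setTensor x s) = if s = ∅ then 1 else 0 :=
    fockForm_vacuum_setTensor α q J x s
  rw [map_smul, happly]
  split_ifs with hs
  · rw [hs, Finset.card_empty, pow_zero, one_smul]
  · rw [smul_zero]

theorem mul_annihilate_coeff_eq (hαq : α * q = 0) (ht : t * (1 + α) = 1) (s : Finset ι)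
    (k : ι) :
    (t : ℂ) * ((q : ℂ) ^ #{i ∈ s | i < k} * (1 + α * (q : ℂ) ^ (2 * #{i ∈ s | k < i}))) =
      (q : ℂ) ^ #{i ∈ s | i < k} * (t : ℂ) ^ (if ∃ i ∈ s, k < i then 1 else 0) := by
  rcases mul_eq_zero.mp hαq with rfl | rfl
  · have ht_one : t = 1 := by simpa using ht
    simp [ht_one]
  · have ht' : (t : ℂ) * (1 + α) = 1 := mod_cast ht
    by_cases hbelow : #{i ∈ s | i < k} = 0
    · by_cases habove : ∃ i ∈ s, k < i
      · have hcard : 2 * #{i ∈ s | k < i} ≠ 0 := by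
          simpa [Finset.filter_eq_empty_iff] using habove
        simp [hbelow, habove, hcard]
      · have hcard : #{i ∈ s | k < i} = 0 := by
          simpa [Finset.filter_eq_empty_iff] using habove
        simp [hbelow, habove, hcard, ht']
    · simp [hbelow]

theorem smul_annihilate_add_creation_setTensor (hαq : α * q = 0) (ht : t * (1 + α) = 1)
    (hc : c * c = t) (x : ι → H) {j : ι} (hj : J (x j) = x j) {s : Finset ι}
    (hjs : ∀ i ∈ s, j < i) :
    ((c : ℂ) • (annihilate α q J (x j) + creation (x j))) ((c : ℂ) ^ #s • setTensor x s) =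
      (c : ℂ) ^ #(insert j s) • setTensor x (insert j s) +
        ∑ k ∈ s, ((q : ℂ) ^ #{i ∈ s | i < k} * (t : ℂ) ^ (if ∃ i ∈ s, k < i then 1 else 0) *
          inner ℂ (x j) (x k)) • (c : ℂ) ^ #(s.erase k) • setTensor x (s.erase k) := by
  have hct : (c : ℂ) * c = t := mod_cast hc
  rw [LinearMap.smul_apply, map_smul, smul_smul, LinearMap.add_apply, smul_add, add_comm,
    setTensor_insert x hjs, Finset.card_insert_of_notMem fun h => lt_irrefl _ (hjs j h),
    ← pow_succ', annihilate_setTensor, hj, Finset.smul_sum]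
  congr 1
  refine Finset.sum_congr rfl fun k hk => ?_
  rw [smul_smul, smul_smul, ← mul_annihilate_coeff_eq hαq ht, ← Finset.card_erase_add_one hk,
    ← hct]
  congr 1
  ring

theorem fockForm_vacuum_prod_gaussian (hαq : α * q = 0) (ht : t * (1 + α) = 1) (hc : c * c = t)
    (hJ : J.IsSymmetric) {n : ℕ} (x : Fin n → H) (hx : ∀ i, J (x i) = x i) :
    fockForm α q J (vacuum H)
        ((List.ofFn fun i => (c : ℂ) • gaussian α q J (x i)).prod (vacuum H)) =
      ∑ π ∈ pairPartitions n,
        (q : ℂ) ^ crossings π * (t : ℂ) ^ innerBlocks π * pairProduct π x := by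
  have hrec := sum_matchingWeight_of_recursion
    (fun i => (c : ℂ) • (annihilate α q J (x i) + creation (x i)))
    (fun s => (c : ℂ) ^ #s • setTensor x s) (vacuumFunctional α q J) q t
    (fun i j => inner ℂ (x i) (x j))
    (vacuumFunctional_pow_smul_setTensor (c : ℂ) x)
    (fun j s hjs => smul_annihilate_add_creation_setTensor hαq ht hc x (hx j) hjs)
    (List.finRange n) (List.pairwise_lt_finRange n) ∅ (by simp)
  rw [Finset.card_empty, pow_zero, one_smul, setTensor_empty, List.toFinset_finRange,
    ← sum_pairPartitions] at hrec
  calc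
    _ = vacuumFunctional α q J (((List.finRange n).map fun i =>
          (c : ℂ) • (annihilate α q J (x i) + creation (x i))).prod (vacuum H)) := by
      rw [List.ofFn_eq_map]
      exact vacuumFunctional_eq_of_sub_mem_radical
        (prod_gaussian_sub_mem_radical hαq hJ c x (List.finRange n) (vacuum H))
    _ = _ := hrec.trans (Finset.sum_congr rfl fun π hπ => matchingWeight_blockPairs hπ q t x)

theorem fockForm_vacuum_prod_gaussian_zero_left (q : ℝ) (hJ : J.IsSymmetric) {n : ℕ}
    (x : Fin n → H) (hx : ∀ i, J (x i) = x i) :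
    fockForm 0 q J (vacuum H)
        ((List.ofFn fun i => gaussian 0 q J (x i)).prod (vacuum H)) =
      ∑ π ∈ pairPartitions n, (q : ℂ) ^ crossings π * pairProduct π x := by
  simpa using fockForm_vacuum_prod_gaussian (t := 1) (c := 1) (zero_mul q) (by norm_num)
    (by norm_num) hJ x hx

theorem fockForm_vacuum_prod_gaussian_zero_right (hα : -1 < α) (hJ : J.IsSymmetric) {n : ℕ}
    (x : Fin n → H) (hx : ∀ i, J (x i) = x i) :
    fockForm α 0 J (vacuum H) ((List.ofFn fun i =>
        ((√(1 / (1 + α)) : ℝ) : ℂ) • gaussian α 0 J (x i)).prod (vacuum H)) =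
      ∑ π ∈ noncrossingPairPartitions n,
        ((1 / (1 + α) : ℝ) : ℂ) ^ innerBlocks π * pairProduct π x := by
  have hpos : 0 < 1 + α := by linarith
  rw [fockForm_vacuum_prod_gaussian (mul_zero α) (one_div_mul_cancel hpos.ne')
    (Real.mul_self_sqrt (one_div_nonneg.mpr hpos.le)) hJ x hx, noncrossingPairPartitions,
    Finset.sum_filter]
  refine Finset.sum_congr rfl fun π _ => ?_
  split_ifs with hcrossings
  · rw [hcrossings, pow_zero, one_mul]
  · rw [Complex.ofReal_zero, zero_pow hcrossings, zero_mul, zero_mul]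

end Moments

end TypeBFock

end

open TypeBFock in
theorem mainTheorem7_general {H : Type*} [NormedAddCommGroup H] [InnerProductSpace ℂ H]
    (J : H →ₗ[ℂ] H) (hJ : Function.Involutive J) (hJsym : J.IsSymmetric) :
    (∀ q : ℝ, (∀ x : H, IsFockAdjoint 0 q J (creation x) (annihilation 0 q J x)) ∧
      ∀ (n : ℕ) (x : Fin n → H), (∀ i, J (x i) = x i) →
        fockForm 0 q J (vacuum H) ((List.ofFn fun i => gaussian 0 q J (x i)).prod (vacuum H)) =
          ∑ π ∈ pairPartitions n, (q : ℂ) ^ crossings π * pairProduct π x) ∧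
    (∀ α t : ℝ, -1 < α → t = 1 / (1 + α) →
      (∀ n : ℕ, 1 ≤ n →
        symmetrizer α 0 J n = LinearMap.id + (α : ℂ) • firstInvolution J n ∧
        (α < 1 → ∀ ξ : ⨂[ℂ]^n H, ξ ≠ 0 → 0 < tensorInner n ξ (symmetrizer α 0 J n ξ)) ∧
        (∀ ξ ∈ Submodule.span ℂ {η : ⨂[ℂ]^n H | ∃ y : Fin n → H,
            (∀ i, J (y i) = y i) ∧ PiTensorProduct.tprod ℂ y = η}, ξ ≠ 0 →
          0 < tensorInner n ξ (symmetrizer α 0 J n ξ))) ∧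
      (∀ x : H, IsFockAdjoint α 0 J (creation x) (annihilation α 0 J x)) ∧
      ∀ (n : ℕ) (x : Fin n → H), (∀ i, J (x i) = x i) →
        fockForm α 0 J (vacuum H) ((List.ofFn fun i =>
            ((√t : ℝ) : ℂ) • gaussian α 0 J (x i)).prod (vacuum H)) =
          ∑ π ∈ noncrossingPairPartitions n, (t : ℂ) ^ innerBlocks π * pairProduct π x) := by
  refine ⟨fun q => ⟨fun x => isFockAdjoint_annihilation x (zero_mul q) hJsym,
    fun n x => fockForm_vacuum_prod_gaussian_zero_left q hJsym x⟩, ?_⟩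
  rintro α _ hα rfl
  refine ⟨fun n hn => ?_, fun x => isFockAdjoint_annihilation x (mul_zero α) hJsym,
    fun n x => fockForm_vacuum_prod_gaussian_zero_right hα hJsym x⟩
  obtain ⟨n, rfl⟩ := Nat.exists_eq_add_of_le' hn
  exact ⟨symmetrizer_zero_right_succ α J,
    fun hα' ξ hξ => tensorInner_symmetrizer_zero_right_pos hα hα' hJ hJsym hξ,
    fun ξ hspan hξ => tensorInner_symmetrizer_zero_right_pos_of_mem_span hα hspan hξ⟩

theorem mainTheorem7 {H : Type*} [NormedAddCommGroup H] [InnerProductSpace ℂ H] [CompleteSpace H]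
    [TopologicalSpace.SeparableSpace H]
    (HR : Submodule ℝ H) (hHR : TypeBFock.IsRealForm HR)
    (J : H →ₗ[ℂ] H) (hJ : Function.Involutive J) (hJsym : J.IsSymmetric) :
    -- the case `α = 0`
    (∀ q : ℝ, -1 < q → q < 1 →
      (∀ x : H, TypeBFock.IsFockAdjoint 0 q J
        (TypeBFock.creation x) (TypeBFock.annihilation 0 q J x)) ∧
      ∀ (m : ℕ) (x : Fin (2 * m) → H), (∀ i, x i ∈ HR) → (∀ i, J (x i) = x i) →
        TypeBFock.fockForm 0 q J (TypeBFock.vacuum H)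
            ((List.ofFn fun i => TypeBFock.gaussian 0 q J (x i)).prod (TypeBFock.vacuum H)) =
          ∑ π ∈ TypeBFock.pairPartitions (2 * m),
            (q : ℂ) ^ TypeBFock.crossings π * TypeBFock.pairProduct π x) ∧
    -- the case `q = 0`
    (∀ α t : ℝ, -1 < α → t = 1 / (1 + α) →
      (∀ n : ℕ, 1 ≤ n →
        TypeBFock.symmetrizer α 0 J n
            = LinearMap.id + (α : ℂ) • TypeBFock.firstInvolution J n ∧
        (α < 1 → ∀ ξ : ⨂[ℂ]^n H, ξ ≠ 0 →
          0 < TypeBFock.tensorInner n ξ (TypeBFock.symmetrizer α 0 J n ξ)) ∧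
        (∀ ξ ∈ Submodule.span ℂ {η : ⨂[ℂ]^n H | ∃ y : Fin n → H,
            (∀ i, J (y i) = y i) ∧ PiTensorProduct.tprod ℂ y = η}, ξ ≠ 0 →
          0 < TypeBFock.tensorInner n ξ (TypeBFock.symmetrizer α 0 J n ξ))) ∧
      (∀ x : H, TypeBFock.IsFockAdjoint α 0 J
        (TypeBFock.creation x) (TypeBFock.annihilation α 0 J x)) ∧
      ∀ (m : ℕ) (x : Fin (2 * m) → H), (∀ i, x i ∈ HR) → (∀ i, J (x i) = x i) →
        TypeBFock.fockForm α 0 J (TypeBFock.vacuum H)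
            ((List.ofFn fun i => ((√t : ℝ) : ℂ) • TypeBFock.gaussian α 0 J (x i)).prod
              (TypeBFock.vacuum H)) =
          ∑ π ∈ TypeBFock.noncrossingPairPartitions (2 * m),
            (t : ℂ) ^ TypeBFock.innerBlocks π * TypeBFock.pairProduct π x) := by
  obtain ⟨h₀, h₁⟩ := mainTheorem7_general J hJ hJsym
  exact ⟨fun q _ _ => ⟨(h₀ q).1, fun m x _ => (h₀ q).2 (2 * m) x⟩, fun α t hα ht =>
    ⟨(h₁ α t hα ht).1, (h₁ α t hα ht).2.1, fun m x _ => (h₁ α t hα ht).2.2 (2 * m) x⟩⟩
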